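/- Let $\mathbb{K}$ be a field, let $R=\mathbb{K}\langle t_1,\dots,t_m\rangle/\langle r_1,\dots,r_s\rangle$, and let $\mathcal{F}_p(R)$ be the span of the images of the words of length at most $p$ in $t_1,\dots,t_m$ (the standard filtration, with $\mathcal F_{-1}(R)=0$). Let $A$ be a $\mathbb{K}$-algebra containing $R$ that is a skew PBW extension of $R$ in $x_1,\dots,x_n\in A$: $A$ is a free left $R$-module with basis the monomials $x^\alpha=x_1^{\alpha_1}\cdots x_n^{\alpha_n}$, $\alpha\in\mathbb{N}^n$; for all $i$ and $0\ne r\in R$ there is $0\neq c\in R$ with $x_ir-cx_i\in R$; and for all $i,j$ there is $0\ne c_{i,j}\in R$ with $x_jx_i-c_{i,j}x_ix_j\in R+Rx_1+\cdots+Rx_n$. Write $$x_ir=\sigma_i(r)x_i+\delta_i(r)\quad(r\in R),\qquad x_jx_i=c_{i,j}x_ix_j+r_{0_{j,i}}+r_{1_{j,i}}x_1+\cdots+r_{n_{j,i}}x_n ,$$ with $\sigma_i(r),\delta_i(r),c_{i,j},r_{l_{j,i}}\in R$. For an element $a\neq 0$ of a filtered algebra, $\deg(a)$ is the least $p$ with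 $a\in\mathcal{F}_p$ (and $\deg 0=0$). For $0\ne f=\sum_\alpha c_\alpha x^\alpha\in A$ let ${\rm tdeg}(f)=\max\{\deg(c_\alpha)+|\alpha| : c_\alpha\neq 0\}$. Assume that $A$ is $\sigma$-filtered, i.e. $\sigma_i(\mathcal{F}_p(R))\subseteq\mathcal{F}_p(R)$ and $\delta_i(\mathcal{F}_p(R))\subseteq\mathcal{F}_{p+1}(R)$ for all $i,p$, and ${\rm tdeg}(x_jx_i)=2$ for all $i,j$. (The $\sigma_i$ need not be graded; the case in which they are is included.) Then $\mathcal{F}_p(A)=\{f : f=0\text{ or }{\rm tdeg}(f)\le p\}$ is a filtration of the algebra $A$ with $\mathcal{F}_p(R)\subseteq\mathcal{F}_p(A)$. For the associated graded algebras $G=\bigoplus_{p\ge 0}\mathcal{F}_p/\mathcal{F}_{p-1}$, write $\overline{a}\in G$ for the coset of $a$ in $\mathcal{F}_p/\mathcal{F}_{p-1}$, $p=\deg(a)$ (with $\overline 0=0$), and put $y_i=\overline{x_i}\in G(A)$. Then, via the induced homomorphism $G(R)\to G(A)$, which is injective, $G(A)$ is a graded skew PBW extension of $G(R)$ in $y_1,\dots,y_n$.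 That is: 1. $G(A)$ is a skew PBW extension of the $\mathbb{N}$-graded algebra $G(R)$ in $y_1,\dots,y_n$; 2. for each $i$ there are a bijective graded ring endomorphism $\sigma$ of $G(R)$ and a $\sigma$-derivation $\delta$ of $G(R)$ of degree $+1$ with $y_ir=\sigma(r)y_i+\delta(r)$ for all $r\in G(R)$; 3. for all $i,j$ there is $0\ne d_{i,j}\in G(R)_0$, invertible if $i<j$, with $y_jy_i-d_{i,j}y_iy_j\in G(R)_2+G(R)_1y_1+\cdots+G(R)_1y_n$. Moreover, for all $1\le i,j\le n$ and $1\le k\le m$, $$y_i\overline{t_k}=\overline{\sigma_i(t_k)}\,y_i+\rho_{i,k},\qquad y_jy_i=\overline{c_{i,j}}\,y_iy_j+\rho_{0_{j,i}}+\rho_{1_{j,i}}y_1+\cdots+\rho_{n_{j,i}}y_n,$$ where $\rho_{i,k}=\overline{\delta_i(t_k)}$ if $\deg(\delta_i(t_k))=2$ and $\rho_{i,k}=0$ otherwise; $\rho_{0_{j,i}}=\overline{r_{0_{j,i}}}$ if $\deg(r_{0_{j,i}})=2$ and $0$ otherwise; and, for $1\le l\le n$, $\rho_{l_{j,i}}=\overline{r_{l_{j,i}}}$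 if $\deg(r_{l_{j,i}})=1$ and $0$ otherwise. -/

import Mathlib

/-! Filtered algebras, associated graded algebras and skew PBW extensions. -/

open scoped DirectSum

universe u v w

/-- A positive filtration `F 0 ⊆ F 1 ⊆ ⋯` (with `F (-1) = 0`) of a `K`-algebra by subspaces. -/
structure AlgFiltration (K : Type u) (R : Type v) [Field K] [Ring R] [Algebra K R] where
  /-- the subspace of elements of degree at most `p` -/
  piece : ℕ → Submodule K R
  mono : Monotone piece
  one_mem : (1 : R) ∈ piece 0
  mul_mem : ∀ {p q : ℕ} {a b : R}, a ∈ piece p → b ∈ piece q → a * b ∈ piece (p + q)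
  exhaustive : ∀ a : R, ∃ p, a ∈ piece p

namespace AlgFiltration

variable {K : Type u} {R : Type v} {A : Type w} [Field K] [Ring R] [Algebra K R]
  [Ring A] [Algebra K A]

/-- The subspace `F (p - 1)`, where `F (-1) = 0`. -/
def below (F : AlgFiltration K R) : ℕ → Submodule K R
  | 0 => ⊥
  | p + 1 => F.piece p

theorem mem_below (F : AlgFiltration K R) {p : ℕ} {a : R} :
    a ∈ F.below p ↔ a = 0 ∨ ∃ q < p, a ∈ F.piece q := by
  cases p with
  | zero => simp [below]
  | succ p =>
    constructor
    · intro h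
      exact Or.inr ⟨p, Nat.lt_succ_self p, h⟩
    · rintro (rfl | ⟨q, hq, h⟩)
      · exact Submodule.zero_mem _
      · exact F.mono (Nat.lt_succ_iff.mp hq) h

theorem mul_mem_below_left (F : AlgFiltration K R) {p q : ℕ} {a b : R}
    (ha : a ∈ F.below p) (hb : b ∈ F.piece q) : a * b ∈ F.below (p + q) := by
  rcases F.mem_below.mp ha with rfl | ⟨i, hi, h⟩
  · simp
  · exact F.mem_below.mpr (Or.inr ⟨i + q, by omega, F.mul_mem h hb⟩)

theorem mul_mem_below_right (F : AlgFiltration K R) {p q : ℕ} {a b : R}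
    (ha : a ∈ F.piece p) (hb : b ∈ F.below q) : a * b ∈ F.below (p + q) := by
  rcases F.mem_below.mp hb with rfl | ⟨i, hi, h⟩
  · simp
  · exact F.mem_below.mpr (Or.inr ⟨p + i, by omega, F.mul_mem ha h⟩)

/-- The degree of an element: the `p` with `a ∈ F p \ F (p - 1)` if `a ≠ 0`, and `0` if `a = 0`. -/
noncomputable def deg (F : AlgFiltration K R) (a : R) : ℕ := sInf {p | a ∈ F.piece p}

theorem mem_piece_deg (F : AlgFiltration K R) (a : R) : a ∈ F.piece (F.deg a) :=
  Nat.sInf_mem (s := {p | a ∈ F.piece p}) (F.exhaustive a)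

/-- The homogeneous component `F p / F (p - 1)` of the associated graded algebra. -/
def Gr (F : AlgFiltration K R) (p : ℕ) : Type v :=
  ↥(F.piece p) ⧸ (F.below p).submoduleOf (F.piece p)

instance instAddCommGroupGr (F : AlgFiltration K R) (p : ℕ) : AddCommGroup (F.Gr p) :=
  inferInstanceAs (AddCommGroup (↥(F.piece p) ⧸ (F.below p).submoduleOf (F.piece p)))

instance instModuleGr (F : AlgFiltration K R) (p : ℕ) : Module K (F.Gr p) :=
  inferInstanceAs (Module K (↥(F.piece p) ⧸ (F.below p).submoduleOf (F.piece p)))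

/-- The coset of `a ∈ F p` in `F p / F (p - 1)`. -/
def coset (F : AlgFiltration K R) {p : ℕ} (a : R) (h : a ∈ F.piece p) : F.Gr p :=
  Submodule.Quotient.mk ⟨a, h⟩

theorem coset_congr (F : AlgFiltration K R) {p q : ℕ} {a b : R} (ha : a ∈ F.piece p)
    (hb : b ∈ F.piece q) (hpq : p = q) (hab : a = b) :
    (⟨p, F.coset a ha⟩ : GradedMonoid F.Gr) = ⟨q, F.coset b hb⟩ := by
  subst hpq hab
  rfl

theorem exists_coset (F : AlgFiltration K R) {p : ℕ} (x : F.Gr p) :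
    ∃ (a : R) (h : a ∈ F.piece p), F.coset a h = x := by
  obtain ⟨⟨a, h⟩, rfl⟩ := Submodule.Quotient.mk_surjective _ x
  exact ⟨a, h, rfl⟩

theorem coset_add (F : AlgFiltration K R) {p : ℕ} (a b : R) (ha : a ∈ F.piece p)
    (hb : b ∈ F.piece p) {c : R} (h : c = a + b) {hc : c ∈ F.piece p} :
    F.coset c hc = F.coset a ha + F.coset b hb := by
  subst h
  rfl

theorem coset_smul (F : AlgFiltration K R) {p : ℕ} (k : K) (a : R) (ha : a ∈ F.piece p)
    {c : R} (h : c = k • a) {hc : c ∈ F.piece p} :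
    F.coset c hc = k • F.coset a ha := by
  subst h
  rfl

/-- Multiplication `F p × F q → F (p + q) / F (p + q - 1)`. -/
def mulAux (F : AlgFiltration K R) (p q : ℕ) :
    ↥(F.piece p) →ₗ[K] ↥(F.piece q) →ₗ[K] F.Gr (p + q) :=
  LinearMap.mk₂ K (fun a b => F.coset (a.1 * b.1) (F.mul_mem a.2 b.2))
    (fun a a' b =>
      F.coset_add _ _ (F.mul_mem a.2 b.2) (F.mul_mem a'.2 b.2) (add_mul a.1 a'.1 b.1))
    (fun k a b =>
      F.coset_smul k _ (F.mul_mem a.2 b.2) (smul_mul_assoc k a.1 b.1))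
    (fun a b b' =>
      F.coset_add _ _ (F.mul_mem a.2 b.2) (F.mul_mem a.2 b'.2) (mul_add a.1 b.1 b'.1))
    (fun k a b =>
      F.coset_smul k _ (F.mul_mem a.2 b.2) (mul_smul_comm k a.1 b.1))

/-- Multiplication `F p × F q / F (q - 1) → F (p + q) / F (p + q - 1)`. -/
def mulAux' (F : AlgFiltration K R) (p q : ℕ) :
    ↥(F.piece p) →ₗ[K] F.Gr q →ₗ[K] F.Gr (p + q) :=
  (Submodule.liftQ _ (F.mulAux p q).flip (by
    intro b hb
    rw [LinearMap.mem_ker]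
    ext a
    exact (Submodule.Quotient.mk_eq_zero _).mpr (F.mul_mem_below_right a.2 hb))).flip

/-- Multiplication of homogeneous components of the associated graded algebra. -/
def grMul (F : AlgFiltration K R) (p q : ℕ) :
    F.Gr p →ₗ[K] F.Gr q →ₗ[K] F.Gr (p + q) :=
  Submodule.liftQ _ (F.mulAux' p q) (by
    intro a ha
    rw [LinearMap.mem_ker]
    refine LinearMap.ext fun x => ?_
    obtain ⟨b, hb, rfl⟩ := F.exists_coset x
    exact (Submodule.Quotient.mk_eq_zero _).mpr (F.mul_mem_below_left ha hb))

theorem grMul_coset (F : AlgFiltration K R) {p q : ℕ} {a b : R} (ha : a ∈ F.piece p)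
    (hb : b ∈ F.piece q) :
    F.grMul p q (F.coset a ha) (F.coset b hb) = F.coset (a * b) (F.mul_mem ha hb) := rfl

instance instGMul (F : AlgFiltration K R) : GradedMonoid.GMul F.Gr where
  mul a b := F.grMul _ _ a b

instance instGOne (F : AlgFiltration K R) : GradedMonoid.GOne F.Gr where
  one := F.coset 1 F.one_mem

instance instGRing (F : AlgFiltration K R) : DirectSum.GRing F.Gr where
  mul_zero a := map_zero (F.grMul _ _ a)
  zero_mul b := LinearMap.map_zero₂ (F.grMul _ _) b
  mul_add a b c := map_add (F.grMul _ _ a) b c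
  add_mul a b c := LinearMap.map_add₂ (F.grMul _ _) a b c
  one_mul := by
    rintro ⟨p, x⟩
    obtain ⟨a, ha, rfl⟩ := F.exists_coset x
    exact F.coset_congr (F.mul_mem F.one_mem ha) ha (zero_add p) (one_mul a)
  mul_one := by
    rintro ⟨p, x⟩
    obtain ⟨a, ha, rfl⟩ := F.exists_coset x
    exact F.coset_congr (F.mul_mem ha F.one_mem) ha (add_zero p) (mul_one a)
  mul_assoc := by
    rintro ⟨p, x⟩ ⟨q, y⟩ ⟨r, z⟩
    obtain ⟨a, ha, rfl⟩ := F.exists_coset x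
    obtain ⟨b, hb, rfl⟩ := F.exists_coset y
    obtain ⟨c, hc, rfl⟩ := F.exists_coset z
    exact F.coset_congr (F.mul_mem (F.mul_mem ha hb) hc) (F.mul_mem ha (F.mul_mem hb hc))
      (add_assoc p q r) (mul_assoc a b c)
  natCast n := n • F.coset 1 F.one_mem
  natCast_zero := zero_smul _ _
  natCast_succ n := succ_nsmul _ _
  intCast n := n • F.coset 1 F.one_mem
  intCast_ofNat n := natCast_zsmul _ _
  intCast_negSucc_ofNat n := negSucc_zsmul _ _

instance instGAlgebra (F : AlgFiltration K R) : DirectSum.GAlgebra K F.Gr where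
  toFun := (LinearMap.toSpanSingleton K (F.Gr 0) (F.coset 1 F.one_mem)).toAddMonoidHom
  map_one := one_smul K (F.coset 1 F.one_mem)
  map_mul r s := by
    exact F.coset_congr (Submodule.smul_mem _ (r * s) F.one_mem)
      (F.mul_mem (Submodule.smul_mem _ r F.one_mem) (Submodule.smul_mem _ s F.one_mem)) rfl
      (by simp [mul_smul, smul_comm r s])
  commutes := by
    rintro k ⟨p, x⟩
    obtain ⟨a, ha, rfl⟩ := F.exists_coset x
    exact F.coset_congr (F.mul_mem (Submodule.smul_mem _ k F.one_mem) ha)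
      (F.mul_mem ha (Submodule.smul_mem _ k F.one_mem)) (add_comm 0 p) (by simp)
  smul_def := by
    rintro k ⟨p, x⟩
    obtain ⟨a, ha, rfl⟩ := F.exists_coset x
    exact F.coset_congr (Submodule.smul_mem _ k ha)
      (F.mul_mem (Submodule.smul_mem _ k F.one_mem) ha) (zero_add p).symm (by simp)

/-- The associated graded algebra `⨁ p, F p / F (p - 1)`, with the product induced from `R`. -/
abbrev G (F : AlgFiltration K R) : Type v := ⨁ p, F.Gr p

/-- The homogeneous component of degree `p`, as a subspace of the associated graded algebra. -/
noncomputable def grading (F : AlgFiltration K R) (p : ℕ) : Submodule K F.G :=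
  LinearMap.range (DirectSum.lof K ℕ F.Gr p)

/-- The coset of `a` in `F p / F (p - 1)`, for `p = deg a`, as an element of the associated graded
algebra (and `0` for `a = 0`). -/
noncomputable def symbol (F : AlgFiltration K R) (a : R) : F.G :=
  DirectSum.of F.Gr (F.deg a) (F.coset a (F.mem_piece_deg a))

/-- The component `F p / F (p - 1) → F' p / F' (p - 1)` of the map of associated graded algebras
induced by an algebra homomorphism that respects the filtrations. -/
def grMapAux (F : AlgFiltration K R) (F' : AlgFiltration K A) (φ : R →ₐ[K] A)
    (h : ∀ p, ∀ a ∈ F.piece p, φ a ∈ F'.piece p) (p : ℕ) : F.Gr p →ₗ[K] F'.Gr p :=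
  Submodule.mapQ _ _ (φ.toLinearMap.restrict (h p)) (by
    rintro ⟨a, ha⟩ hb
    rcases F.mem_below.mp (show a ∈ F.below p from hb) with rfl | ⟨q, hq, hq'⟩
    · exact F'.mem_below.mpr (Or.inl (map_zero φ))
    · exact F'.mem_below.mpr (Or.inr ⟨q, hq, h q _ hq'⟩))

/-- The homomorphism of associated graded algebras induced by an algebra homomorphism that respects
the filtrations. -/
noncomputable def grMap (F : AlgFiltration K R) (F' : AlgFiltration K A) (φ : R →ₐ[K] A)
    (h : ∀ p, ∀ a ∈ F.piece p, φ a ∈ F'.piece p) : F.G →ₐ[K] F'.G :=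
  DirectSum.toAlgebra K F.Gr (fun p => (DirectSum.lof K ℕ F'.Gr p) ∘ₗ F.grMapAux F' φ h p)
    (by
      exact DirectSum.of_eq_of_gradedMonoid_eq (F'.coset_congr (h 0 _ F.one_mem) F'.one_mem rfl
        (map_one φ)))
    (by
      intro p q x y
      obtain ⟨a, ha, rfl⟩ := F.exists_coset x
      obtain ⟨b, hb, rfl⟩ := F.exists_coset y
      refine Eq.trans ?_ (DirectSum.of_mul_of _ _).symm
      exact DirectSum.of_eq_of_gradedMonoid_eq (F'.coset_congr (h _ _ (F.mul_mem ha hb))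
        (F'.mul_mem (h p a ha) (h q b hb)) rfl (map_mul φ a b)))

end AlgFiltration

/-- `R` is the algebra `K⟨t₁, …, tₘ⟩ / ⟨r₁, …, rₛ⟩`, with `π` as the quotient map. -/
structure IsPresentation {K : Type u} {R : Type v} [Field K] [Ring R] [Algebra K R] {m s : ℕ}
    (r : Fin s → FreeAlgebra K (Fin m)) (π : FreeAlgebra K (Fin m) →ₐ[K] R) : Prop where
  surjective : Function.Surjective π
  ker_eq : TwoSidedIdeal.ker π = TwoSidedIdeal.span (Set.range r)

/-- The standard filtration of a quotient of `K⟨t₁, …, tₘ⟩`: the piece of index `p` is spanned by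
the images of the words of length at most `p` in the generators. -/
def stdFiltration {K : Type u} {R : Type v} [Field K] [Ring R] [Algebra K R] {m : ℕ}
    (π : FreeAlgebra K (Fin m) →ₐ[K] R) (hπ : Function.Surjective π) : AlgFiltration K R where
  piece p := Submodule.span K
    {a | ∃ l : List (Fin m), l.length ≤ p ∧ a = (l.map fun k => π (FreeAlgebra.ι K k)).prod}
  mono p q hpq := Submodule.span_mono fun a ⟨l, hl, h⟩ => ⟨l, hl.trans hpq, h⟩
  one_mem := Submodule.subset_span ⟨[], by simp⟩
  mul_mem {p q a b} ha hb := by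
    have h := Submodule.mul_mem_mul ha hb
    rw [Submodule.span_mul_span] at h
    refine Submodule.span_mono ?_ h
    rintro _ ⟨_, ⟨l, hl, rfl⟩, _, ⟨l', hl', rfl⟩, rfl⟩
    exact ⟨l ++ l', by simpa using add_le_add hl hl', by simp⟩
  exhaustive a := by
    obtain ⟨f, rfl⟩ := hπ a
    induction f using FreeAlgebra.induction with
    | grade0 k =>
      refine ⟨0, ?_⟩
      rw [AlgHom.commutes, Algebra.algebraMap_eq_smul_one]
      exact Submodule.smul_mem _ _ (Submodule.subset_span ⟨[], by simp⟩)
    | grade1 k => exact ⟨1, Submodule.subset_span ⟨[k], by simp⟩⟩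
    | mul f g hf hg =>
      obtain ⟨p, hp⟩ := hf
      obtain ⟨q, hq⟩ := hg
      refine ⟨p + q, ?_⟩
      have h := Submodule.mul_mem_mul hp hq
      rw [Submodule.span_mul_span] at h
      rw [map_mul]
      refine Submodule.span_mono ?_ h
      rintro _ ⟨_, ⟨l, hl, rfl⟩, _, ⟨l', hl', rfl⟩, rfl⟩
      exact ⟨l ++ l', by simpa using add_le_add hl hl', by simp⟩
    | add f g hf hg =>
      obtain ⟨p, hp⟩ := hf
      obtain ⟨q, hq⟩ := hg
      refine ⟨max p q, ?_⟩
      rw [map_add]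
      exact Submodule.add_mem _
        (Submodule.span_mono (by
          rintro a ⟨l, hl, h⟩
          exact ⟨l, hl.trans (le_max_left p q), h⟩) hp)
        (Submodule.span_mono (by
          rintro a ⟨l, hl, h⟩
          exact ⟨l, hl.trans (le_max_right p q), h⟩) hq)

/-- The standard monomial `x₁ ^ α₁ ⋯ xₙ ^ αₙ`. -/
def stdMonomial {A : Type w} [Ring A] {n : ℕ} (x : Fin n → A) (α : Fin n → ℕ) : A :=
  (List.ofFn fun i => x i ^ α i).prod

/-- `A` is a skew PBW extension of `R` in the elements `x₁, …, xₙ`, where the injective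
homomorphism `φ` makes `R` a subring of `A`. -/
structure IsSkewPBW {K : Type u} {R : Type v} {A : Type w} [Field K] [Ring R] [Algebra K R]
    [Ring A] [Algebra K A] {n : ℕ} (φ : R →ₐ[K] A) (x : Fin n → A) : Prop where
  injective : Function.Injective φ
  /-- `A` is a free left `R`-module on the standard monomials. -/
  basis : ∀ a : A, ∃! f : (Fin n → ℕ) →₀ R, a = f.sum fun α c => φ c * stdMonomial x α
  comm_coeff : ∀ (i : Fin n) (r : R), r ≠ 0 →
    ∃ c : R, c ≠ 0 ∧ ∃ e : R, x i * φ r - φ c * x i = φ e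
  comm_var : ∀ i j : Fin n, ∃ d : R, d ≠ 0 ∧ ∃ (e : R) (f : Fin n → R),
    x j * x i - φ d * (x i * x j) = φ e + ∑ l, φ (f l) * x l

namespace IsSkewPBW

variable {K : Type u} {R : Type v} {A : Type w} [Field K] [Ring R] [Algebra K R]
  [Ring A] [Algebra K A] {n : ℕ} {φ : R →ₐ[K] A} {x : Fin n → A}

/-- The coefficients of an element of `A` on the standard monomials. -/
noncomputable def coeff (h : IsSkewPBW φ x) (a : A) : (Fin n → ℕ) →₀ R :=
  (h.basis a).choose

/-- The map `σᵢ` in `xᵢ r = σᵢ(r) xᵢ + δᵢ(r)`. -/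
noncomputable def sigma (h : IsSkewPBW φ x) (i : Fin n) (r : R) : R :=
  h.coeff (x i * φ r) (Pi.single i 1)

/-- The map `δᵢ` in `xᵢ r = σᵢ(r) xᵢ + δᵢ(r)`. -/
noncomputable def delta (h : IsSkewPBW φ x) (i : Fin n) (r : R) : R :=
  h.coeff (x i * φ r) 0

/-- The total degree: the maximum of `deg c + |α|` over the terms `c x^α` with `c ≠ 0`
(and `0` for the element `0`). -/
noncomputable def tdeg (h : IsSkewPBW φ x) (F : AlgFiltration K R) (a : A) : ℕ :=
  (h.coeff a).support.sup fun α => F.deg (h.coeff a α) + ∑ i, α i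

/-- `A` is a `σ`-filtered skew PBW extension of the filtered algebra `R`: the maps `σᵢ` and `δᵢ`
are filtered and `A` preserves the total degree. -/
structure IsSigmaFiltered (h : IsSkewPBW φ x) (F : AlgFiltration K R) : Prop where
  sigma_mem : ∀ (i : Fin n) (p : ℕ), ∀ r ∈ F.piece p, h.sigma i r ∈ F.piece p
  delta_mem : ∀ (i : Fin n) (p : ℕ), ∀ r ∈ F.piece p, h.delta i r ∈ F.piece (p + 1)
  tdeg_eq : ∀ i j : Fin n, h.tdeg F (x j * x i) = 2

end IsSkewPBW

/-- `A` is a graded skew PBW extension, in the elements `x₁, …, xₙ`, of the algebra `R` with the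
`ℕ`-grading `S`: a bijective skew PBW extension whose endomorphisms `σᵢ` are graded, whose
`σᵢ`-derivations `δᵢ` have degree `1`, and for which
`xⱼ xᵢ - dᵢⱼ xᵢ xⱼ ∈ S₂ + S₁ x₁ + ⋯ + S₁ xₙ` with `dᵢⱼ ∈ S₀`. -/
structure IsGradedSkewPBW {K : Type u} {R : Type v} {A : Type w} [Field K] [Ring R] [Algebra K R]
    [Ring A] [Algebra K A] {n : ℕ} (S : ℕ → Submodule K R) (φ : R →ₐ[K] A) (x : Fin n → A) :
    Prop where
  isSkewPBW : IsSkewPBW φ x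
  isInternal : DirectSum.IsInternal S
  gradedMonoid : SetLike.GradedMonoid S
  coeff_rel : ∀ i : Fin n, ∃ (σ : R →+* R) (δ : R →+ R),
    (∀ r, x i * φ r = φ (σ r) * x i + φ (δ r)) ∧
    (∀ r r', δ (r * r') = σ r * δ r' + δ r * r') ∧
    Function.Bijective σ ∧
    (∀ p, ∀ r ∈ S p, σ r ∈ S p) ∧
    (∀ p, ∀ r ∈ S p, δ r ∈ S (p + 1))
  var_rel : ∀ i j : Fin n, ∃ d ∈ S 0, d ≠ 0 ∧ (i < j → IsUnit d) ∧
    ∃ e ∈ S 2, ∃ f : Fin n → R, (∀ l, f l ∈ S 1) ∧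
      x j * x i - φ d * (x i * x j) = φ e + ∑ l, φ (f l) * x l

/-! Two facts about the standard filtration of `R` drive the proof: every piece is
finite-dimensional, and the piece of degree 0 consists of scalars.

The total degree gives a filtration of `A` because left multiplication by `xᵢ` raises it by at most
1. On standard monomials this is a rewriting argument by double induction
(`var_mul_stdMonomial_mem`): a smaller variable is moved to the front, and the correction terms have
controlled total degree because `tdeg (xⱼ xᵢ) = 2`.

Taking the coefficient on `x^α` respects the filtrations, so it induces maps `grCoeff` from `G(A)`
to `G(R)`. They read off the coefficients of a combination of monomials in the `yᵢ`; hence those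
monomials are left independent over `G(R)` and `G(R) → G(A)` is injective. They span because the
coset of an element is the sum of the cosets of its terms.

An injective filtered map need not be injective on associated graded algebras. Here `σᵢ` maps each
finite-dimensional piece injectively into itself, hence onto itself; so its inverse is filtered and
`σᵢ` induces a bijection of `G(R)` (`grEnd_bijective`). Finally, each `cᵢⱼ` is a nonzero element of
degree 0, hence a nonzero scalar and a unit (`rel_mem`). The relations of `G(A)` are the cosets of
those of `A` in the appropriate degree. -/

namespace AlgFiltration

variable {K : Type u} {R : Type v} {A : Type w} [Field K] [Ring R] [Algebra K R]
  [Ring A] [Algebra K A]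

/-! ### Cosets in a prescribed degree and maps on the associated graded algebra. -/

theorem below_mono (F : AlgFiltration K R) : Monotone F.below := by
  intro p q hpq a ha
  rcases F.mem_below.mp ha with rfl | ⟨i, hi, h⟩
  · exact Submodule.zero_mem _
  · exact F.mem_below.mpr (Or.inr ⟨i, by omega, h⟩)

theorem deg_le_iff (F : AlgFiltration K R) {a : R} {p : ℕ} : F.deg a ≤ p ↔ a ∈ F.piece p :=
  ⟨fun h => F.mono h (F.mem_piece_deg a), fun h => Nat.sInf_le h⟩

/-- The coset in degree `p` of an element of the `p`-th piece, as an element of the associated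
graded algebra. -/
noncomputable def toG (F : AlgFiltration K R) (p : ℕ) : ↥(F.piece p) →ₗ[K] F.G :=
  (DirectSum.lof K ℕ F.Gr p) ∘ₗ (Submodule.mkQ ((F.below p).submoduleOf (F.piece p)))

theorem toG_eq_of (F : AlgFiltration K R) {p : ℕ} {a : R} (ha : a ∈ F.piece p) :
    F.toG p ⟨a, ha⟩ = DirectSum.of F.Gr p (F.coset a ha) := rfl

theorem toG_congr (F : AlgFiltration K R) {p q : ℕ} {a b : R} (ha : a ∈ F.piece p)
    (hb : b ∈ F.piece q) (hpq : p = q) (hab : a = b) : F.toG p ⟨a, ha⟩ = F.toG q ⟨b, hb⟩ := by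
  subst hpq hab
  rfl

theorem toG_eq_zero (F : AlgFiltration K R) {p : ℕ} {a : R} (ha : a ∈ F.piece p)
    (h : a ∈ F.below p) : F.toG p ⟨a, ha⟩ = 0 := by
  rw [toG_eq_of, show F.coset a ha = 0 from (Submodule.Quotient.mk_eq_zero _).mpr h, map_zero]

theorem toG_mul (F : AlgFiltration K R) {p q : ℕ} {a b : R} (ha : a ∈ F.piece p)
    (hb : b ∈ F.piece q) :
    F.toG p ⟨a, ha⟩ * F.toG q ⟨b, hb⟩ = F.toG (p + q) ⟨a * b, F.mul_mem ha hb⟩ :=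
  DirectSum.of_mul_of _ _

theorem toG_sum (F : AlgFiltration K R) {ι : Type*} (s : Finset ι) {p : ℕ} {a : ι → R}
    (ha : ∀ i, a i ∈ F.piece p) :
    ∑ i ∈ s, F.toG p ⟨a i, ha i⟩ =
      F.toG p ⟨∑ i ∈ s, a i, Submodule.sum_mem _ fun i _ => ha i⟩ := by
  rw [← map_sum]
  congr 1
  exact Subtype.ext (AddSubmonoidClass.coe_finsetSum _ _)

theorem toG_one (F : AlgFiltration K R) : F.toG 0 ⟨1, F.one_mem⟩ = 1 := rfl

theorem algebraMap_mem_piece_zero (F : AlgFiltration K R) (k : K) :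
    algebraMap K R k ∈ F.piece 0 := by
  rw [Algebra.algebraMap_eq_smul_one]
  exact Submodule.smul_mem _ _ F.one_mem

theorem toG_algebraMap (F : AlgFiltration K R) (k : K) :
    F.toG 0 ⟨algebraMap K R k, F.algebraMap_mem_piece_zero k⟩ = algebraMap K F.G k := by
  rw [Algebra.algebraMap_eq_smul_one (A := F.G), ← F.toG_one, ← map_smul]
  exact F.toG_congr _ _ rfl (Algebra.algebraMap_eq_smul_one k)

instance nontrivial_G (F : AlgFiltration K R) [Nontrivial R] : Nontrivial F.G := by
  refine ⟨1, 0, fun h0 => ?_⟩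
  have h1 : F.coset 1 F.one_mem = 0 :=
    DirectSum.of_injective (β := F.Gr) 0 (h0.trans (map_zero _).symm)
  exact one_ne_zero (α := R)
    ((Submodule.Quotient.mk_eq_zero ((F.below 0).submoduleOf (F.piece 0))).mp h1)

theorem symbol_eq_toG (F : AlgFiltration K R) {p : ℕ} {a : R} (ha : a ∈ F.piece p)
    (h : F.deg a = p) : F.symbol a = F.toG p ⟨a, ha⟩ := by
  subst h
  rfl

/-- The symbol is not additive, whereas the coset in a fixed degree is linear but vanishes on
elements of lower degree. This comparison produces the case distinctions on degrees in the final
relations. -/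
theorem toG_eq_ite_symbol (F : AlgFiltration K R) {p : ℕ} {a : R} (ha : a ∈ F.piece p) :
    F.toG p ⟨a, ha⟩ = if F.deg a = p then F.symbol a else 0 := by
  split_ifs with h
  · exact (F.symbol_eq_toG ha h).symm
  · exact F.toG_eq_zero ha (F.mem_below.mpr (Or.inr
      ⟨F.deg a, lt_of_le_of_ne (F.deg_le_iff.mpr ha) h, F.mem_piece_deg a⟩))

theorem G_induction (F : AlgFiltration K R) {P : F.G → Prop} (zero : P 0)
    (toG : ∀ p a (ha : a ∈ F.piece p), P (F.toG p ⟨a, ha⟩))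
    (add : ∀ g g', P g → P g' → P (g + g')) (g : F.G) : P g := by
  induction g using DirectSum.induction_on with
  | zero => exact zero
  | of p x =>
    obtain ⟨a, ha, rfl⟩ := F.exists_coset x
    exact toG p a ha
  | add g g' hg hg' => exact add g g' hg hg'

theorem mem_grading (F : AlgFiltration K R) {p : ℕ} {g : F.G} :
    g ∈ F.grading p ↔ ∃ (a : R) (ha : a ∈ F.piece p), F.toG p ⟨a, ha⟩ = g := by
  constructor
  · rintro ⟨x, rfl⟩
    obtain ⟨a, ha, rfl⟩ := F.exists_coset x
    exact ⟨a, ha, rfl⟩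
  · rintro ⟨a, ha, rfl⟩
    exact ⟨_, rfl⟩

theorem toG_mem_grading (F : AlgFiltration K R) {p : ℕ} (a : ↥(F.piece p)) :
    F.toG p a ∈ F.grading p :=
  F.mem_grading.mpr ⟨a.1, a.2, rfl⟩

theorem gradedMonoid_grading (F : AlgFiltration K R) : SetLike.GradedMonoid F.grading where
  one_mem := F.toG_mem_grading ⟨1, F.one_mem⟩
  mul_mem := by
    intro p q g g' hg hg'
    obtain ⟨a, ha, rfl⟩ := F.mem_grading.mp hg
    obtain ⟨b, hb, rfl⟩ := F.mem_grading.mp hg'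
    rw [F.toG_mul ha hb]
    exact F.toG_mem_grading _

theorem isInternal_grading (F : AlgFiltration K R) : DirectSum.IsInternal F.grading := by
  -- The inverse of the summation map regards each component as an element of its image in the
  -- direct sum.
  let D : F.G →ₗ[K] ⨁ p, F.grading p :=
    DirectSum.lmap fun p => (DirectSum.lof K ℕ F.Gr p).rangeRestrict
  refine Function.bijective_iff_has_inverse.mpr ⟨D, ?_, ?_⟩
  · intro z
    induction z using DirectSum.induction_on with
    | zero => simp
    | of p x =>
      obtain ⟨_, x, rfl⟩ := x
      rw [DirectSum.coeAddMonoidHom_of]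
      exact DirectSum.lmap_lof _ _ _
    | add z z' hz hz' => rw [map_add, map_add, hz, hz']
  · intro g
    induction g using DirectSum.induction_on with
    | zero => simp
    | of p x =>
      rw [show D (DirectSum.of F.Gr p x) = _ from DirectSum.lmap_lof _ _ _]
      exact DirectSum.coeAddMonoidHom_of _ _ _
    | add z z' hz hz' => rw [map_add, map_add, hz, hz']

/-- A linear map from the associated graded algebra, given by linear maps on the pieces. -/
noncomputable def lift {M : Type*} [AddCommGroup M] [Module K M] (F : AlgFiltration K R)
    (f : ∀ p, ↥(F.piece p) →ₗ[K] M)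
    (hf : ∀ p a (ha : a ∈ F.piece p), a ∈ F.below p → f p ⟨a, ha⟩ = 0) : F.G →ₗ[K] M :=
  DirectSum.toModule K ℕ M fun p =>
    Submodule.liftQ ((F.below p).submoduleOf (F.piece p)) (f p) fun a ha => hf p a.1 a.2 ha

theorem lift_toG {M : Type*} [AddCommGroup M] [Module K M] (F : AlgFiltration K R)
    (f : ∀ p, ↥(F.piece p) →ₗ[K] M)
    (hf : ∀ p a (ha : a ∈ F.piece p), a ∈ F.below p → f p ⟨a, ha⟩ = 0) (p : ℕ)
    (a : ↥(F.piece p)) : F.lift f hf (F.toG p a) = f p a := by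
  refine (DirectSum.toModule_lof K p _).trans ?_
  exact Submodule.liftQ_apply _ _ _

/-- The map of degree `d` induced on the associated graded algebra by a linear map that raises
the filtration degree by at most `d`. -/
noncomputable def grLin (F : AlgFiltration K R) (d : ℕ) (f : R →ₗ[K] R)
    (hf : ∀ p, ∀ a ∈ F.piece p, f a ∈ F.piece (p + d)) : F.G →ₗ[K] F.G :=
  F.lift (fun p => F.toG (p + d) ∘ₗ f.restrict (hf p)) (by
    intro p a ha h
    refine F.toG_eq_zero (hf p a ha) ?_
    rcases F.mem_below.mp h with rfl | ⟨q, hq, h'⟩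
    · rw [map_zero]
      exact Submodule.zero_mem _
    · exact F.mem_below.mpr (Or.inr ⟨q + d, by omega, hf q a h'⟩))

theorem grLin_toG (F : AlgFiltration K R) (d : ℕ) (f : R →ₗ[K] R)
    (hf : ∀ p, ∀ a ∈ F.piece p, f a ∈ F.piece (p + d)) {p : ℕ} {a : R} (ha : a ∈ F.piece p) :
    F.grLin d f hf (F.toG p ⟨a, ha⟩) = F.toG (p + d) ⟨f a, hf p a ha⟩ :=
  F.lift_toG _ _ _ _

theorem grLin_mem_grading (F : AlgFiltration K R) (d : ℕ) (f : R →ₗ[K] R)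
    (hf : ∀ p, ∀ a ∈ F.piece p, f a ∈ F.piece (p + d)) {p : ℕ} {g : F.G} (hg : g ∈ F.grading p) :
    F.grLin d f hf g ∈ F.grading (p + d) := by
  obtain ⟨a, ha, rfl⟩ := F.mem_grading.mp hg
  rw [F.grLin_toG d f hf ha]
  exact F.toG_mem_grading _

/-- The ring endomorphism of the associated graded algebra induced by a filtered algebra
endomorphism. -/
noncomputable def grEnd (F : AlgFiltration K R) (f : R →ₐ[K] R)
    (hf : ∀ p, ∀ a ∈ F.piece p, f a ∈ F.piece p) : F.G →+* F.G :=
  (F.grMap F f hf).toRingHom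

theorem grMap_toG (F : AlgFiltration K R) (F' : AlgFiltration K A) (φ : R →ₐ[K] A)
    (h : ∀ p, ∀ a ∈ F.piece p, φ a ∈ F'.piece p) {p : ℕ} {a : R} (ha : a ∈ F.piece p) :
    F.grMap F' φ h (F.toG p ⟨a, ha⟩) = F'.toG p ⟨φ a, h p a ha⟩ :=
  DirectSum.toModule_lof K p _

theorem grEnd_toG (F : AlgFiltration K R) (f : R →ₐ[K] R)
    (hf : ∀ p, ∀ a ∈ F.piece p, f a ∈ F.piece p) {p : ℕ} {a : R} (ha : a ∈ F.piece p) :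
    F.grEnd f hf (F.toG p ⟨a, ha⟩) = F.toG p ⟨f a, hf p a ha⟩ :=
  F.grMap_toG F f hf ha

theorem grEnd_mem_grading (F : AlgFiltration K R) (f : R →ₐ[K] R)
    (hf : ∀ p, ∀ a ∈ F.piece p, f a ∈ F.piece p) {p : ℕ} {g : F.G} (hg : g ∈ F.grading p) :
    F.grEnd f hf g ∈ F.grading p := by
  obtain ⟨a, ha, rfl⟩ := F.mem_grading.mp hg
  rw [F.grEnd_toG f hf ha]
  exact F.toG_mem_grading _

/-! ### Injective filtered endomorphisms on finite-dimensional pieces. -/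

/-- An injective filtered endomorphism maps each finite-dimensional piece onto itself. -/
theorem exists_mem_piece_eq (F : AlgFiltration K R)
    (hF : ∀ p, FiniteDimensional K ↥(F.piece p)) (f : R →ₐ[K] R) (hinj : Function.Injective f)
    (hf : ∀ p, ∀ a ∈ F.piece p, f a ∈ F.piece p) {p : ℕ} {b : R} (hb : b ∈ F.piece p) :
    ∃ a ∈ F.piece p, f a = b := by
  have := hF p
  have h : Function.Injective (f.toLinearMap.restrict (hf p)) := by
    intro a a' haa
    exact Subtype.ext (hinj (congrArg Subtype.val haa))
  obtain ⟨a, ha⟩ := LinearMap.injective_iff_surjective.mp h ⟨b, hb⟩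
  exact ⟨a.1, a.2, congrArg Subtype.val ha⟩

/-- The image already has a preimage inside the piece, and injectivity makes it the only one. So the
inverse map is filtered too. -/
theorem mem_piece_of_apply_mem (F : AlgFiltration K R)
    (hF : ∀ p, FiniteDimensional K ↥(F.piece p)) (f : R →ₐ[K] R) (hinj : Function.Injective f)
    (hf : ∀ p, ∀ a ∈ F.piece p, f a ∈ F.piece p) {p : ℕ} {a : R} (ha : f a ∈ F.piece p) :
    a ∈ F.piece p := by
  obtain ⟨b, hb, hab⟩ := F.exists_mem_piece_eq hF f hinj hf ha
  rwa [← hinj hab]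

theorem deg_apply (F : AlgFiltration K R)
    (hF : ∀ p, FiniteDimensional K ↥(F.piece p)) (f : R →ₐ[K] R) (hinj : Function.Injective f)
    (hf : ∀ p, ∀ a ∈ F.piece p, f a ∈ F.piece p) (a : R) : F.deg (f a) = F.deg a :=
  le_antisymm (F.deg_le_iff.mpr (hf _ _ (F.mem_piece_deg a)))
    (F.deg_le_iff.mpr (F.mem_piece_of_apply_mem hF f hinj hf (F.mem_piece_deg (f a))))

theorem grEnd_bijective (F : AlgFiltration K R)
    (hF : ∀ p, FiniteDimensional K ↥(F.piece p)) (f : R →ₐ[K] R) (hinj : Function.Injective f)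
    (hf : ∀ p, ∀ a ∈ F.piece p, f a ∈ F.piece p) : Function.Bijective (F.grEnd f hf) := by
  have hsurj : Function.Surjective f := fun b => by
    obtain ⟨a, -, ha⟩ := F.exists_mem_piece_eq hF f hinj hf (F.mem_piece_deg b)
    exact ⟨a, ha⟩
  let e := AlgEquiv.ofBijective f ⟨hinj, hsurj⟩
  have he : ∀ p, ∀ a ∈ F.piece p, (e.symm : R →ₐ[K] R) a ∈ F.piece p := fun p a ha =>
    F.mem_piece_of_apply_mem hF f hinj hf
      (by rwa [show f ((e.symm : R →ₐ[K] R) a) = a from e.apply_symm_apply a])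
  refine Function.bijective_iff_has_inverse.mpr ⟨F.grEnd (e.symm : R →ₐ[K] R) he, ?_, ?_⟩
  · intro g
    induction g using F.G_induction with
    | zero => simp
    | toG p a ha =>
      rw [F.grEnd_toG f hf ha, F.grEnd_toG _ he]
      exact F.toG_congr _ _ rfl (e.symm_apply_apply a)
    | add g g' hg hg' => rw [map_add, map_add, hg, hg']
  · intro g
    induction g using F.G_induction with
    | zero => simp
    | toG p a ha =>
      rw [F.grEnd_toG _ he ha, F.grEnd_toG]
      exact F.toG_congr _ _ rfl (e.apply_symm_apply a)
    | add g g' hg hg' => rw [map_add, map_add, hg, hg']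

/-! ### Cosets of products and of standard monomials. -/

/-- `g` is the coset of `a` in degree `p`. -/
def IsCoset (F : AlgFiltration K R) (p : ℕ) (a : R) (g : F.G) : Prop :=
  ∃ h : a ∈ F.piece p, g = F.toG p ⟨a, h⟩

theorem IsCoset.mul {F : AlgFiltration K R} {p q : ℕ} {a b : R} {g g' : F.G}
    (h : F.IsCoset p a g) (h' : F.IsCoset q b g') : F.IsCoset (p + q) (a * b) (g * g') := by
  obtain ⟨ha, rfl⟩ := h
  obtain ⟨hb, rfl⟩ := h'
  exact ⟨F.mul_mem ha hb, F.toG_mul ha hb⟩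

theorem IsCoset.pow {F : AlgFiltration K R} {a : R} {g : F.G} (h : F.IsCoset 1 a g) (k : ℕ) :
    F.IsCoset k (a ^ k) (g ^ k) := by
  induction k with
  | zero => exact ⟨by simpa using F.one_mem, by simpa using F.toG_one.symm⟩
  | succ k ih => simpa only [pow_succ] using ih.mul h

theorem IsCoset.prod_ofFn {F : AlgFiltration K R} {n : ℕ} {p : Fin n → ℕ} {a : Fin n → R}
    {g : Fin n → F.G} (h : ∀ i, F.IsCoset (p i) (a i) (g i)) :
    F.IsCoset (∑ i, p i) (List.ofFn a).prod (List.ofFn g).prod := by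
  induction n with
  | zero =>
    simp only [List.ofFn_zero, List.prod_nil, Finset.univ_eq_empty, Finset.sum_empty]
    exact ⟨F.one_mem, F.toG_one.symm⟩
  | succ n ih =>
    simp only [Fin.sum_univ_succ, List.ofFn_succ, List.prod_cons]
    exact (h 0).mul (ih fun i => h i.succ)

theorem IsCoset.stdMonomial {F : AlgFiltration K R} {n : ℕ} {x : Fin n → R} {y : Fin n → F.G}
    (h : ∀ i, F.IsCoset 1 (x i) (y i)) (α : Fin n → ℕ) :
    F.IsCoset (∑ i, α i) (stdMonomial x α) (stdMonomial y α) :=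
  IsCoset.prod_ofFn fun i => (h i).pow (α i)

end AlgFiltration

/-! ### The standard filtration: finite-dimensional pieces, scalars in degree 0. -/

theorem stdFiltration_finiteDimensional {K : Type u} {R : Type v} [Field K] [Ring R] [Algebra K R]
    {m : ℕ} (π : FreeAlgebra K (Fin m) →ₐ[K] R) (hπ : Function.Surjective π) (p : ℕ) :
    FiniteDimensional K ↥((stdFiltration π hπ).piece p) := by
  refine FiniteDimensional.span_of_finite K ?_
  refine ((List.finite_length_le (Fin m) p).image
    fun l => (l.map fun k => π (FreeAlgebra.ι K k)).prod).subset ?_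
  rintro a ⟨l, hl, rfl⟩
  exact ⟨l, hl, rfl⟩

theorem mem_stdFiltration_zero {K : Type u} {R : Type v} [Field K] [Ring R] [Algebra K R]
    {m : ℕ} {π : FreeAlgebra K (Fin m) →ₐ[K] R} {hπ : Function.Surjective π} {a : R}
    (ha : a ∈ (stdFiltration π hπ).piece 0) : ∃ k : K, a = algebraMap K R k := by
  have h : (stdFiltration π hπ).piece 0 ≤ Submodule.span K {1} := by
    refine Submodule.span_mono ?_
    rintro a ⟨l, hl, rfl⟩
    obtain rfl := List.length_eq_zero_iff.mp (Nat.le_zero.mp hl)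
    simp
  obtain ⟨k, rfl⟩ := Submodule.mem_span_singleton.mp (h ha)
  exact ⟨k, (Algebra.algebraMap_eq_smul_one k).symm⟩

/-! ### Standard monomials and their exponents. -/

theorem mul_prod_ofFn_of_forall_lt_eq_one {M : Type*} [Monoid M] {n : ℕ} (a : M) (f g : Fin n → M)
    (i : Fin n) (hlt : ∀ j < i, f j = 1) (hi : g i = a * f i) (hne : ∀ j, j ≠ i → g j = f j) :
    a * (List.ofFn f).prod = (List.ofFn g).prod := by
  induction n with
  | zero => exact i.elim0
  | succ n ih =>
    simp only [List.ofFn_succ, List.prod_cons]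
    induction i using Fin.cases with
    | zero =>
      have hfg : (fun j : Fin n => f j.succ) = fun j => g j.succ :=
        funext fun j => (hne _ (Fin.succ_ne_zero j)).symm
      rw [hi, mul_assoc, hfg]
    | succ i =>
      rw [hne 0 (Fin.succ_ne_zero i).symm, hlt 0 (Fin.succ_pos i), one_mul, one_mul]
      exact ih _ _ i (fun j hj => hlt _ (Fin.succ_lt_succ_iff.mpr hj)) hi
        fun j hj => hne _ fun h => hj (Fin.succ_injective _ h)

theorem mul_stdMonomial {A : Type w} [Ring A] {n : ℕ} (x : Fin n → A) {i : Fin n} {α : Fin n → ℕ}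
    (h : ∀ j < i, α j = 0) : x i * stdMonomial x α = stdMonomial x (α + Pi.single i 1) := by
  refine mul_prod_ofFn_of_forall_lt_eq_one _ _ _ i (fun j hj => ?_) ?_ fun j hj => ?_
  · rw [h j hj, pow_zero]
  · simp [pow_succ']
  · simp [hj]

theorem stdMonomial_zero {A : Type w} [Ring A] {n : ℕ} (x : Fin n → A) :
    stdMonomial x 0 = 1 := by
  simp [stdMonomial]

theorem stdMonomial_single {A : Type w} [Ring A] {n : ℕ} (x : Fin n → A) (i : Fin n) :
    stdMonomial x (Pi.single i 1) = x i := by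
  have h := mul_stdMonomial x (i := i) (α := 0) fun _ _ => rfl
  rw [zero_add, stdMonomial_zero, mul_one] at h
  exact h.symm

theorem stdMonomial_single_add_single {A : Type w} [Ring A] {n : ℕ} (x : Fin n → A) {i j : Fin n}
    (h : i ≤ j) : stdMonomial x (Pi.single j 1 + Pi.single i 1) = x i * x j := by
  rw [← mul_stdMonomial x, stdMonomial_single]
  intro k hk
  rw [Pi.single_eq_of_ne (hk.trans_le h).ne]

theorem sum_add_single {n : ℕ} (α : Fin n → ℕ) (i : Fin n) :
    ∑ k, (α + Pi.single i 1 : Fin n → ℕ) k = (∑ k, α k) + 1 := by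
  simp [Finset.sum_add_distrib]

/-- A nonzero exponent is obtained by raising one whose earlier entries vanish. -/
theorem exists_eq_add_single {n : ℕ} {α : Fin n → ℕ} {i : Fin n} (hi : α i ≠ 0) :
    ∃ (j : Fin n) (β : Fin n → ℕ), j ≤ i ∧ α = β + Pi.single j 1 ∧ ∀ k < j, β k = 0 := by
  induction i using WellFoundedLT.induction with
  | ind i ih =>
    by_cases h : ∃ j < i, α j ≠ 0
    · obtain ⟨j, hj, hj'⟩ := h
      obtain ⟨k, β, hk, h⟩ := ih j hj hj'
      exact ⟨k, β, hk.trans hj.le, h⟩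
    · push Not at h
      refine ⟨i, α - Pi.single i 1, le_rfl, ?_, fun k hk => by simp [h k hk]⟩
      ext k
      rcases eq_or_ne k i with rfl | hk
      · simp only [Pi.add_apply, Pi.sub_apply, Pi.single_eq_same]
        omega
      · simp [hk]

/-! ### Coefficients and the maps `σᵢ`, `δᵢ`. -/

namespace IsSkewPBW

variable {K : Type u} {R : Type v} {A : Type w} [Field K] [Ring R] [Algebra K R]
  [Ring A] [Algebra K A] {n : ℕ} {φ : R →ₐ[K] A} {x : Fin n → A}

theorem sum_coeff (h : IsSkewPBW φ x) (a : A) :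
    (h.coeff a).sum (fun α c => φ c * stdMonomial x α) = a :=
  (h.basis a).choose_spec.1.symm

theorem coeff_eq (h : IsSkewPBW φ x) {a : A} {f : (Fin n → ℕ) →₀ R}
    (hf : f.sum (fun α c => φ c * stdMonomial x α) = a) : h.coeff a = f :=
  ((h.basis a).choose_spec.2 f hf.symm).symm

theorem ext_coeff (h : IsSkewPBW φ x) {a b : A} (hab : ∀ α, h.coeff a α = h.coeff b α) :
    a = b := by
  rw [← h.sum_coeff a, ← h.sum_coeff b, Finsupp.ext hab]

theorem coeff_add (h : IsSkewPBW φ x) (a b : A) : h.coeff (a + b) = h.coeff a + h.coeff b := by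
  refine h.coeff_eq ?_
  rw [Finsupp.sum_add_index' (by simp) (by simp [add_mul]), h.sum_coeff, h.sum_coeff]

theorem coeff_zero (h : IsSkewPBW φ x) : h.coeff 0 = 0 := h.coeff_eq (by simp)

theorem coeff_map_mul (h : IsSkewPBW φ x) (r : R) (a : A) (α : Fin n → ℕ) :
    h.coeff (φ r * a) α = r * h.coeff a α := by
  rw [h.coeff_eq (f := (h.coeff a).mapRange (r * ·) (mul_zero r))]
  · simp
  · rw [Finsupp.sum_mapRange_index (by simp)]
    conv_rhs => rw [← h.sum_coeff a, Finsupp.mul_sum]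
    simp [mul_assoc]

theorem coeff_smul (h : IsSkewPBW φ x) (k : K) (a : A) : h.coeff (k • a) = k • h.coeff a := by
  ext α
  have := h.coeff_map_mul (algebraMap K R k) a α
  rwa [AlgHom.commutes, ← Algebra.smul_def, ← Algebra.smul_def] at this

/-- The coefficient on a standard monomial, as a linear map. -/
noncomputable def coeffLin (h : IsSkewPBW φ x) (α : Fin n → ℕ) : A →ₗ[K] R where
  toFun a := h.coeff a α
  map_add' a b := by rw [h.coeff_add, Finsupp.add_apply]
  map_smul' k a := by rw [h.coeff_smul, Finsupp.smul_apply, RingHom.id_apply]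

theorem coeff_sum (h : IsSkewPBW φ x) {ι : Type*} (s : Finset ι) (a : ι → A) (α : Fin n → ℕ) :
    h.coeff (∑ k ∈ s, a k) α = ∑ k ∈ s, h.coeff (a k) α :=
  map_sum (h.coeffLin α) a s

theorem coeff_stdMonomial (h : IsSkewPBW φ x) (α β : Fin n → ℕ) :
    h.coeff (stdMonomial x α) β = if α = β then 1 else 0 := by
  rw [h.coeff_eq (f := Finsupp.single α 1) (by simp), Finsupp.single_apply]

theorem coeff_monomial (h : IsSkewPBW φ x) (r : R) (α β : Fin n → ℕ) :
    h.coeff (φ r * stdMonomial x α) β = if α = β then r else 0 := by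
  rw [h.coeff_map_mul, h.coeff_stdMonomial]
  simp

theorem coeff_map (h : IsSkewPBW φ x) (r : R) (β : Fin n → ℕ) :
    h.coeff (φ r) β = if 0 = β then r else 0 := by
  rw [← h.coeff_monomial, stdMonomial_zero, mul_one]

theorem coeff_map_mul_var (h : IsSkewPBW φ x) (r : R) (i : Fin n) (β : Fin n → ℕ) :
    h.coeff (φ r * x i) β = if Pi.single i 1 = β then r else 0 := by
  rw [← h.coeff_monomial, stdMonomial_single]

theorem coeff_linear_single (h : IsSkewPBW φ x) (c e : R) (i : Fin n) :
    h.coeff (φ c * x i + φ e) (Pi.single i 1) = c := by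
  rw [h.coeff_add, Finsupp.add_apply, h.coeff_map_mul_var, h.coeff_map, if_pos rfl,
    if_neg (Pi.single_ne_zero_iff.mpr one_ne_zero).symm, add_zero]

theorem coeff_linear_zero (h : IsSkewPBW φ x) (c e : R) (i : Fin n) :
    h.coeff (φ c * x i + φ e) 0 = e := by
  rw [h.coeff_add, Finsupp.add_apply, h.coeff_map_mul_var, h.coeff_map, if_pos rfl,
    if_neg (Pi.single_ne_zero_iff.mpr one_ne_zero), zero_add]

theorem sigma_eq (h : IsSkewPBW φ x) {i : Fin n} {r c e : R}
    (hr : x i * φ r = φ c * x i + φ e) : h.sigma i r = c := by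
  rw [sigma, hr, h.coeff_linear_single]

theorem delta_eq (h : IsSkewPBW φ x) {i : Fin n} {r c e : R}
    (hr : x i * φ r = φ c * x i + φ e) : h.delta i r = e := by
  rw [delta, hr, h.coeff_linear_zero]

theorem var_mul_map (h : IsSkewPBW φ x) (i : Fin n) (r : R) :
    x i * φ r = φ (h.sigma i r) * x i + φ (h.delta i r) := by
  rcases eq_or_ne r 0 with rfl | hr
  · have h0 : x i * φ 0 = φ 0 * x i + φ 0 := by simp
    rw [h.sigma_eq h0, h.delta_eq h0, ← h0]
  · obtain ⟨c, -, e, he⟩ := h.comm_coeff i r hr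
    have h0 : x i * φ r = φ c * x i + φ e := by rw [← he]; abel
    rw [h.sigma_eq h0, h.delta_eq h0, ← h0]

theorem sigma_ne_zero (h : IsSkewPBW φ x) (i : Fin n) {r : R} (hr : r ≠ 0) :
    h.sigma i r ≠ 0 := by
  obtain ⟨c, hc, e, he⟩ := h.comm_coeff i r hr
  rwa [h.sigma_eq (c := c) (e := e) (by rw [← he]; abel)]

/-- Moving `xᵢ` past `r` and then past `s`; uniqueness of coefficients turns this one identity into
both the multiplicativity of `σᵢ` and the twisted Leibniz rule for `δᵢ`. -/
theorem var_mul_map_mul (h : IsSkewPBW φ x) (i : Fin n) (r s : R) :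
    x i * φ (r * s) = φ (h.sigma i r * h.sigma i s) * x i +
      φ (h.sigma i r * h.delta i s + h.delta i r * s) := by
  rw [map_mul, ← mul_assoc, h.var_mul_map, add_mul, mul_assoc, h.var_mul_map]
  simp only [map_add, map_mul, mul_add, mul_assoc, add_assoc]

theorem var_mul_map_one (i : Fin n) : x i * φ 1 = φ 1 * x i + φ 0 := by
  simp

theorem var_mul_map_add (h : IsSkewPBW φ x) (i : Fin n) (r s : R) :
    x i * φ (r + s) = φ (h.sigma i r + h.sigma i s) * x i + φ (h.delta i r + h.delta i s) := by
  rw [map_add, mul_add, h.var_mul_map, h.var_mul_map]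
  simp only [map_add, add_mul]
  abel

theorem var_mul_map_smul (h : IsSkewPBW φ x) (i : Fin n) (k : K) (r : R) :
    x i * φ (k • r) = φ (k • h.sigma i r) * x i + φ (k • h.delta i r) := by
  rw [map_smul, mul_smul_comm, h.var_mul_map, smul_add, map_smul, map_smul, smul_mul_assoc]

/-- The endomorphism `σᵢ`. -/
noncomputable def sigmaHom (h : IsSkewPBW φ x) (i : Fin n) : R →ₐ[K] R :=
  AlgHom.ofLinearMap
    { toFun := h.sigma i
      map_add' := fun r s => h.sigma_eq (h.var_mul_map_add i r s)
      map_smul' := fun k r => h.sigma_eq (h.var_mul_map_smul i k r) }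
    (h.sigma_eq (var_mul_map_one i)) fun r s => h.sigma_eq (h.var_mul_map_mul i r s)

theorem sigmaHom_injective (h : IsSkewPBW φ x) (i : Fin n) :
    Function.Injective (h.sigmaHom i) := by
  refine (injective_iff_map_eq_zero _).mpr fun r hr => ?_
  by_contra hne
  exact h.sigma_ne_zero i hne hr

/-- The `σᵢ`-derivation `δᵢ`, as a linear map. -/
noncomputable def deltaLin (h : IsSkewPBW φ x) (i : Fin n) : R →ₗ[K] R where
  toFun := h.delta i
  map_add' r s := h.delta_eq (h.var_mul_map_add i r s)
  map_smul' k r := h.delta_eq (h.var_mul_map_smul i k r)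

theorem deltaLin_apply (h : IsSkewPBW φ x) (i : Fin n) (r : R) :
    h.deltaLin i r = h.delta i r := rfl

theorem delta_mul (h : IsSkewPBW φ x) (i : Fin n) (r s : R) :
    h.delta i (r * s) = h.sigma i r * h.delta i s + h.delta i r * s :=
  h.delta_eq (h.var_mul_map_mul i r s)

theorem delta_algebraMap (h : IsSkewPBW φ x) (i : Fin n) (k : K) :
    h.delta i (algebraMap K R k) = 0 := by
  have h1 : h.delta i 1 = 0 := h.delta_eq (var_mul_map_one i)
  rw [Algebra.algebraMap_eq_smul_one, ← h.deltaLin_apply, map_smul, h.deltaLin_apply, h1, smul_zero]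

/-- A variable is needed: without variables, `R` and `A` may both be zero. -/
theorem nontrivial (h : IsSkewPBW φ x) (i : Fin n) : Nontrivial R := by
  obtain ⟨d, hd, -⟩ := h.comm_var i i
  exact ⟨d, 0, hd⟩

/-! ### Total degree and the coefficients of the defining relations. -/

/-- With truncated subtraction, `F.below (p + 1 - |α|)` is the piece of degree `p - |α|` when `|α| ≤
p` and is zero when `|α| > p`. Both cases, and zero coefficients, are thus covered by one linear
condition. -/
theorem tdeg_le_iff (h : IsSkewPBW φ x) (F : AlgFiltration K R) {a : A} {p : ℕ} :
    h.tdeg F a ≤ p ↔ ∀ α, h.coeff a α ∈ F.below (p + 1 - ∑ i, α i) := by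
  rw [tdeg, Finset.sup_le_iff]
  refine forall_congr' fun α => ?_
  by_cases h0 : h.coeff a α = 0
  · simp [h0]
  · rw [Finsupp.mem_support_iff, imp_iff_right h0, F.mem_below, or_iff_right h0]
    constructor
    · intro hle
      exact ⟨_, by omega, F.mem_piece_deg _⟩
    · rintro ⟨q, hq, hm⟩
      have := F.deg_le_iff.mpr hm
      omega

/-- The elements of total degree at most `p`. -/
noncomputable def tdegLE (h : IsSkewPBW φ x) (F : AlgFiltration K R) (p : ℕ) : Submodule K A :=
  ⨅ α : Fin n → ℕ, (F.below (p + 1 - ∑ i, α i)).comap (h.coeffLin α)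

theorem mem_tdegLE (h : IsSkewPBW φ x) {F : AlgFiltration K R} {p : ℕ} {a : A} :
    a ∈ h.tdegLE F p ↔ ∀ α, h.coeff a α ∈ F.below (p + 1 - ∑ i, α i) := by
  rw [tdegLE, Submodule.mem_iInf]
  rfl

theorem tdegLE_mono (h : IsSkewPBW φ x) (F : AlgFiltration K R) : Monotone (h.tdegLE F) := by
  intro p q hpq a ha
  rw [mem_tdegLE] at ha ⊢
  exact fun α => F.below_mono (by omega) (ha α)

theorem monomial_mem_tdegLE (h : IsSkewPBW φ x) {F : AlgFiltration K R} {p q : ℕ} {r : R}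
    {α : Fin n → ℕ} (hr : r ∈ F.piece q) (hp : q + ∑ i, α i ≤ p) :
    φ r * stdMonomial x α ∈ h.tdegLE F p := by
  rw [mem_tdegLE]
  intro β
  rw [h.coeff_monomial]
  split_ifs with hαβ
  · subst hαβ
    exact F.mem_below.mpr (Or.inr ⟨q, by omega, hr⟩)
  · exact Submodule.zero_mem _

theorem tdegLE_le (h : IsSkewPBW φ x) {F : AlgFiltration K R} {p : ℕ} {N : Submodule K A}
    (hN : ∀ q r α, r ∈ F.piece q → q + ∑ i, α i ≤ p → φ r * stdMonomial x α ∈ N) :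
    h.tdegLE F p ≤ N := by
  intro a ha
  rw [← h.sum_coeff a]
  refine Submodule.sum_mem _ fun α _ => ?_
  rcases F.mem_below.mp (h.mem_tdegLE.mp ha α) with h0 | ⟨q, hq, hm⟩
  · simp [h0]
  · exact hN q _ α hm (by omega)

theorem stdMonomial_mem_tdegLE (h : IsSkewPBW φ x) {F : AlgFiltration K R} {p : ℕ}
    {α : Fin n → ℕ} (hp : ∑ i, α i ≤ p) : stdMonomial x α ∈ h.tdegLE F p := by
  simpa using h.monomial_mem_tdegLE (α := α) F.one_mem (by simpa using hp)

theorem map_mem_tdegLE (h : IsSkewPBW φ x) {F : AlgFiltration K R} {p : ℕ} {r : R}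
    (hr : r ∈ F.piece p) : φ r ∈ h.tdegLE F p := by
  simpa [stdMonomial_zero] using h.monomial_mem_tdegLE (α := 0) hr (p := p) (by simp)

theorem map_mul_mem_tdegLE (h : IsSkewPBW φ x) {F : AlgFiltration K R} {p q : ℕ} {r : R} {a : A}
    (hr : r ∈ F.piece p) (ha : a ∈ h.tdegLE F q) : φ r * a ∈ h.tdegLE F (p + q) := by
  refine h.tdegLE_le (N := (h.tdegLE F (p + q)).comap (LinearMap.mulLeft K (φ r))) ?_ ha
  intro k s α hs hk
  rw [Submodule.mem_comap, LinearMap.mulLeft_apply, ← mul_assoc, ← map_mul]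
  exact h.monomial_mem_tdegLE (F.mul_mem hr hs) (by omega)

theorem exists_rel (h : IsSkewPBW φ x) (i j : Fin n) : ∃ (d e : R) (f : Fin n → R), d ≠ 0 ∧
    x j * x i = φ d * (x i * x j) + φ e + ∑ l, φ (f l) * x l := by
  obtain ⟨d, hd, e, f, hf⟩ := h.comm_var i j
  exact ⟨d, e, f, hd, by rw [add_assoc, ← hf]; abel⟩

/-- For `i ≤ j` the product `xᵢ xⱼ` is itself a standard monomial, so the right-hand side is already
in normal form; exponents of total size 2, 0 and 1 cannot collide. -/
theorem coeff_rel (h : IsSkewPBW φ x) {i j : Fin n} (hij : i ≤ j) {c e : R} {f : Fin n → R}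
    {a : A} (ha : a = φ c * (x i * x j) + φ e + ∑ l, φ (f l) * x l) :
    h.coeff a (Pi.single j 1 + Pi.single i 1) = c ∧ h.coeff a 0 = e ∧
      ∀ l, h.coeff a (Pi.single l 1) = f l := by
  have hsum : ∀ l, ∑ k, (Pi.single l 1 : Fin n → ℕ) k = 1 := fun l => by simp
  have hsum' : ∑ k, (Pi.single j 1 + Pi.single i 1 : Fin n → ℕ) k = 2 := by
    rw [sum_add_single, hsum]
  have h1 : (Pi.single j 1 + Pi.single i 1 : Fin n → ℕ) ≠ 0 := fun h0 => by
    rw [h0] at hsum'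
    simp at hsum'
  have h2 : ∀ l, (Pi.single j 1 + Pi.single i 1 : Fin n → ℕ) ≠ Pi.single l 1 := fun l hl => by
    rw [hl, hsum] at hsum'
    omega
  have key : ∀ β, h.coeff a β = (if Pi.single j 1 + Pi.single i 1 = β then c else 0) +
      (if 0 = β then e else 0) + ∑ l, if Pi.single l 1 = β then f l else 0 := fun β => by
    rw [ha, ← stdMonomial_single_add_single x hij]
    simp only [h.coeff_add, Finsupp.add_apply, h.coeff_monomial, h.coeff_map, h.coeff_sum,
      h.coeff_map_mul_var]
  refine ⟨?_, ?_, fun l => ?_⟩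
  · simp [key, h1.symm, fun l => (h2 l).symm]
  · simp [key, h1]
  · have h3 : ∀ k, (Pi.single k 1 : Fin n → ℕ) = Pi.single l 1 ↔ k = l := fun k =>
      ⟨fun hk => by simpa [Pi.single_apply] using congrFun hk k, fun hk => by rw [hk]⟩
    have h4 : (0 : Fin n → ℕ) ≠ Pi.single l 1 := (Pi.single_ne_zero_iff.mpr one_ne_zero).symm
    simp [key, h2, h3, h4]

/-! ### The total degree filtration of a `σ`-filtered extension. -/

section SigmaFiltered

variable {h : IsSkewPBW φ x} {F : AlgFiltration K R}

theorem IsSigmaFiltered.var_mul_var_mem (hF : h.IsSigmaFiltered F) (i j : Fin n) :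
    x j * x i ∈ h.tdegLE F 2 :=
  h.mem_tdegLE.mpr ((h.tdeg_le_iff F).mp (hF.tdeg_eq i j).le)

theorem IsSigmaFiltered.rel_mem_of_le (hF : h.IsSigmaFiltered F) {i j : Fin n} (hij : i ≤ j)
    {c e : R} {f : Fin n → R} (hrel : x j * x i = φ c * (x i * x j) + φ e + ∑ l, φ (f l) * x l) :
    c ≠ 0 ∧ c ∈ F.piece 0 ∧ e ∈ F.piece 2 ∧ ∀ l, f l ∈ F.piece 1 := by
  obtain ⟨h1, h2, h3⟩ := h.coeff_rel hij hrel
  have hm := h.mem_tdegLE.mp (hF.var_mul_var_mem i j)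
  refine ⟨?_, ?_, ?_, fun l => ?_⟩
  -- The given `c` is the same coefficient as the nonzero `d` supplied by the definition of a skew
  -- PBW extension.
  · obtain ⟨d, e', f', hd, hd'⟩ := h.exists_rel i j
    rwa [← h1, (h.coeff_rel hij hd').1]
  · have := hm (Pi.single j 1 + Pi.single i 1)
    rw [h1, sum_add_single] at this
    simpa [AlgFiltration.below] using this
  · have := hm 0
    rw [h2] at this
    simpa [AlgFiltration.below] using this
  · have := hm (Pi.single l 1)
    rw [h3] at this
    simpa [AlgFiltration.below] using this

theorem IsSigmaFiltered.rel_mem (hF : h.IsSigmaFiltered F)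
    (hF0 : ∀ r ∈ F.piece 0, ∃ k : K, r = algebraMap K R k) (i j : Fin n)
    {c e : R} {f : Fin n → R} (hrel : x j * x i = φ c * (x i * x j) + φ e + ∑ l, φ (f l) * x l) :
    (∃ k : K, k ≠ 0 ∧ c = algebraMap K R k) ∧ e ∈ F.piece 2 ∧ ∀ l, f l ∈ F.piece 1 := by
  have hF0' : ∀ c ∈ F.piece 0, c ≠ 0 → ∃ k : K, k ≠ 0 ∧ c = algebraMap K R k := by
    intro c hc hc0
    obtain ⟨k, rfl⟩ := hF0 c hc
    exact ⟨k, fun hk => hc0 (by rw [hk, map_zero]), rfl⟩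
  rcases le_total i j with hij | hij
  · obtain ⟨h1, h2, h3⟩ := hF.rel_mem_of_le hij hrel
    exact ⟨hF0' c h2 h1, h3⟩
  · obtain ⟨d, e', f', -, hd⟩ := h.exists_rel j i
    obtain ⟨hd0, hd1, he', hf'⟩ := hF.rel_mem_of_le hij hd
    -- Here `xⱼ xᵢ` is the standard monomial. Substituting the relation for `xᵢ xⱼ` and comparing
    -- with the trivial relation `hone` gives `c d = 1`, `c e' + e = 0` and `c f'ₗ + fₗ = 0`. As `d`
    -- is a nonzero scalar, `c` is its inverse and the bounds on `e'` and `f'` pass to `e` and `f`.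
    have hrel' : x j * x i =
        φ (c * d) * (x j * x i) + φ (c * e' + e) + ∑ l, φ (c * f' l + f l) * x l := by
      conv_lhs => rw [hrel, hd]
      simp only [mul_add, map_add, map_mul, Finset.mul_sum, add_mul, Finset.sum_add_distrib,
        mul_assoc]
      abel
    have hone : x j * x i = φ 1 * (x j * x i) + φ 0 + ∑ l : Fin n, φ ((fun _ => 0) l) * x l := by
      simp
    obtain ⟨h1, h2, h3⟩ := h.coeff_rel hij hrel'
    obtain ⟨h1', h2', h3'⟩ := h.coeff_rel hij hone
    obtain ⟨k, hk, rfl⟩ := hF0' d hd1 hd0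
    have hc : c = algebraMap K R k⁻¹ := by
      have := h1.symm.trans h1'
      calc c = c * (algebraMap K R k * algebraMap K R k⁻¹) := by
            rw [← map_mul, mul_inv_cancel₀ hk, map_one, mul_one]
        _ = _ := by rw [← mul_assoc, this, one_mul]
    have hmul : ∀ {p r s}, r ∈ F.piece p → c * r + s = 0 → s ∈ F.piece p := by
      intro p r s hr hs
      rw [eq_neg_of_add_eq_zero_right hs, hc, ← Algebra.smul_def]
      exact Submodule.neg_mem _ (Submodule.smul_mem _ _ hr)
    exact ⟨⟨k⁻¹, inv_ne_zero hk, hc⟩, hmul he' (h2.symm.trans h2'), fun l =>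
      hmul (hf' l) ((h3 l).symm.trans (h3' l))⟩

/-- The hypothesis is limited to monomials of size at most `p`, so that the lemma can be used inside
the induction that proves the bound for all monomials. -/
theorem IsSigmaFiltered.var_mul_mem_of_forall (hF : h.IsSigmaFiltered F) {i : Fin n} {p : ℕ}
    (hi : ∀ α : Fin n → ℕ, ∑ k, α k ≤ p → x i * stdMonomial x α ∈ h.tdegLE F (∑ k, α k + 1))
    {a : A} (ha : a ∈ h.tdegLE F p) : x i * a ∈ h.tdegLE F (p + 1) := by
  refine h.tdegLE_le (N := (h.tdegLE F (p + 1)).comap (LinearMap.mulLeft K (x i))) ?_ ha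
  intro q r α hr hq
  rw [Submodule.mem_comap, LinearMap.mulLeft_apply, ← mul_assoc, h.var_mul_map, add_mul, mul_assoc]
  refine Submodule.add_mem _ ?_ (h.monomial_mem_tdegLE (hF.delta_mem i q r hr) (by omega))
  exact h.tdegLE_mono F (by omega)
    (h.map_mul_mem_tdegLE (hF.sigma_mem i q r hr) (hi α (by omega)))

/-- Outer induction on `|α|`, inner induction on `i`. If no variable below `xᵢ` occurs, the product
is a standard monomial. Otherwise `x^α = xⱼ x^β` with `j < i`, and `xᵢ xⱼ` is rewritten with `xⱼ` in
front. -/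
theorem IsSigmaFiltered.var_mul_stdMonomial_mem (hF : h.IsSigmaFiltered F) (i : Fin n)
    (α : Fin n → ℕ) : x i * stdMonomial x α ∈ h.tdegLE F (∑ k, α k + 1) := by
  induction hk : ∑ k, α k using Nat.strong_induction_on generalizing i α with
  | _ p ihp =>
  subst hk
  induction i using WellFoundedLT.induction generalizing α with
  | ind i ihi =>
  by_cases hmin : ∀ j < i, α j = 0
  · rw [mul_stdMonomial x hmin]
    exact h.stdMonomial_mem_tdegLE (sum_add_single α i).le
  · push Not at hmin
    obtain ⟨j', hj', hα⟩ := hmin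
    obtain ⟨j, β, hj, rfl, hβ⟩ := exists_eq_add_single hα
    have hji : j < i := hj.trans_lt hj'
    rw [sum_add_single] at ihp ⊢
    obtain ⟨d, e, f, -, hd⟩ := h.exists_rel j i
    obtain ⟨-, hd0, he, hf⟩ := hF.rel_mem_of_le hji.le hd
    rw [← mul_stdMonomial x hβ, ← mul_assoc, hd, add_mul, add_mul, Finset.sum_mul]
    have hvar : ∀ l, x l * stdMonomial x β ∈ h.tdegLE F (∑ k, β k + 1) := fun l =>
      ihp _ (Nat.lt_succ_self _) l β rfl
    refine Submodule.add_mem _ (Submodule.add_mem _ ?_ ?_) (Submodule.sum_mem _ fun l _ => ?_)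
    · rw [mul_assoc, mul_assoc]
      refine h.tdegLE_mono F (by omega) (h.map_mul_mem_tdegLE hd0
        (hF.var_mul_mem_of_forall (fun γ hγ => ?_) (hvar i)))
      -- In `xⱼ (xᵢ x^β)` the inner product has monomials of size at most `|β| + 1 = |α|`. Smaller
      -- ones fall under the outer induction; those of equal size under the inner one, since `j <
      -- i`.
      rcases hγ.lt_or_eq with hlt | heq
      · exact ihp _ hlt j γ rfl
      · refine ihi j hji γ fun q hq l δ hδ => ihp q (by omega) l δ hδ
    · exact h.monomial_mem_tdegLE he (by omega)
    · rw [mul_assoc]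
      exact h.tdegLE_mono F (by omega) (h.map_mul_mem_tdegLE (hf l) (hvar l))

theorem IsSigmaFiltered.var_mul_mem (hF : h.IsSigmaFiltered F) (i : Fin n) {p : ℕ} {a : A}
    (ha : a ∈ h.tdegLE F p) : x i * a ∈ h.tdegLE F (p + 1) :=
  hF.var_mul_mem_of_forall (fun α _ => hF.var_mul_stdMonomial_mem i α) ha

theorem IsSigmaFiltered.stdMonomial_mul_mem (hF : h.IsSigmaFiltered F) (α : Fin n → ℕ) {p : ℕ}
    {a : A} (ha : a ∈ h.tdegLE F p) : stdMonomial x α * a ∈ h.tdegLE F (∑ k, α k + p) := by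
  induction hk : ∑ k, α k generalizing α with
  | zero =>
    obtain rfl : α = 0 := by
      ext i
      simpa using (Finset.sum_eq_zero_iff.mp hk) i (Finset.mem_univ i)
    simpa [stdMonomial_zero] using ha
  | succ k ih =>
    obtain ⟨i, hi⟩ : ∃ i, α i ≠ 0 := by
      by_contra! h0
      simp [h0] at hk
    obtain ⟨j, β, -, rfl, hβ⟩ := exists_eq_add_single hi
    rw [sum_add_single] at hk
    rw [← mul_stdMonomial x hβ, mul_assoc]
    exact h.tdegLE_mono F (by omega) (hF.var_mul_mem j (ih β (by omega)))

/-- The filtration of a `σ`-filtered skew PBW extension by the total degree. -/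
noncomputable def IsSigmaFiltered.filtration (hF : h.IsSigmaFiltered F) : AlgFiltration K A where
  piece := h.tdegLE F
  mono := h.tdegLE_mono F
  one_mem := by simpa using h.map_mem_tdegLE F.one_mem
  mul_mem {p q a b} ha hb := by
    refine h.tdegLE_le (N := (h.tdegLE F (p + q)).comap (LinearMap.mulRight K b)) ?_ ha
    intro k r α hr hk
    rw [Submodule.mem_comap, LinearMap.mulRight_apply, mul_assoc]
    exact h.tdegLE_mono F (by omega) (h.map_mul_mem_tdegLE hr (hF.stdMonomial_mul_mem α hb))
  exhaustive a := ⟨h.tdeg F a, h.mem_tdegLE.mpr ((h.tdeg_le_iff F).mp le_rfl)⟩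

theorem IsSigmaFiltered.mem_filtration (hF : h.IsSigmaFiltered F) {p : ℕ} {a : A} :
    a ∈ hF.filtration.piece p ↔ h.tdeg F a ≤ p :=
  h.mem_tdegLE.trans (h.tdeg_le_iff F).symm

/-- The condition is uniform in `p`: for `p = 0` it says that all coefficients vanish. It makes the
coefficient maps well defined on cosets. -/
theorem IsSigmaFiltered.mem_filtration_below (hF : h.IsSigmaFiltered F) {p : ℕ} {a : A} :
    a ∈ hF.filtration.below p ↔ ∀ α, h.coeff a α ∈ F.below (p - ∑ i, α i) := by
  cases p with
  | zero =>
    simp only [AlgFiltration.below, Submodule.mem_bot, Nat.zero_sub]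
    refine ⟨fun h0 α => by rw [h0, h.coeff_zero, Finsupp.zero_apply], fun h0 => h.ext_coeff ?_⟩
    simpa [h.coeff_zero] using h0
  | succ p => exact h.mem_tdegLE

end SigmaFiltered

end IsSkewPBW

/-! ### The algebra `G(A)` over `G(R)`: basis and commutation rules. -/

namespace IsSkewPBW

variable {K : Type u} {R : Type v} {A : Type w} [Field K] [Ring R] [Algebra K R]
  [Ring A] [Algebra K A] {n : ℕ} {φ : R →ₐ[K] A} {x : Fin n → A}
  {h : IsSkewPBW φ x} {F : AlgFiltration K R}

namespace IsSigmaFiltered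

theorem var_mem (hF : h.IsSigmaFiltered F) (i : Fin n) : x i ∈ hF.filtration.piece 1 := by
  rw [← stdMonomial_single x i]
  exact h.stdMonomial_mem_tdegLE (by simp)

theorem map_mem (hF : h.IsSigmaFiltered F) (p : ℕ) (r : R) (hr : r ∈ F.piece p) :
    φ r ∈ hF.filtration.piece p :=
  h.map_mem_tdegLE hr

theorem deg_var (hF : h.IsSigmaFiltered F) (i : Fin n) : hF.filtration.deg (x i) = 1 := by
  have := h.nontrivial i
  refine le_antisymm (hF.filtration.deg_le_iff.mpr (hF.var_mem i)) ?_
  by_contra hlt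
  have hle : hF.filtration.deg (x i) ≤ 0 := by omega
  have h0 := h.mem_tdegLE.mp (hF.filtration.deg_le_iff.mp hle) (Pi.single i 1)
  -- Total degree 0 would force the coefficient of `xᵢ` on itself, which is 1, into `F.below 0 = 0`.
  rw [← stdMonomial_single x i, h.coeff_stdMonomial] at h0
  simp [AlgFiltration.below] at h0

theorem isCoset_var (hF : h.IsSigmaFiltered F) (i : Fin n) :
    hF.filtration.IsCoset 1 (x i) (hF.filtration.symbol (x i)) :=
  ⟨hF.var_mem i, hF.filtration.symbol_eq_toG _ (hF.deg_var i)⟩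

/-- The map `G(R) → G(A)`. -/
noncomputable abbrev Phi (hF : h.IsSigmaFiltered F) : F.G →ₐ[K] hF.filtration.G :=
  F.grMap hF.filtration φ hF.map_mem

theorem isCoset_Phi (hF : h.IsSigmaFiltered F) {p : ℕ} {r : R} (hr : r ∈ F.piece p) :
    hF.filtration.IsCoset p (φ r) (hF.Phi (F.toG p ⟨r, hr⟩)) :=
  ⟨hF.map_mem p r hr, F.grMap_toG _ φ hF.map_mem hr⟩

theorem isCoset_monomial (hF : h.IsSigmaFiltered F) {p : ℕ} {r : R} (hr : r ∈ F.piece p)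
    (α : Fin n → ℕ) : hF.filtration.IsCoset (p + ∑ i, α i) (φ r * stdMonomial x α)
      (hF.Phi (F.toG p ⟨r, hr⟩) * stdMonomial (fun i => hF.filtration.symbol (x i)) α) :=
  (hF.isCoset_Phi hr).mul (.stdMonomial hF.isCoset_var α)

theorem coeff_mem (hF : h.IsSigmaFiltered F) {p : ℕ} {a : A} (ha : a ∈ hF.filtration.piece p)
    (α : Fin n → ℕ) : h.coeff a α ∈ F.piece (p - ∑ i, α i) := by
  rcases F.mem_below.mp (h.mem_tdegLE.mp ha α) with h0 | ⟨q, hq, hm⟩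
  · rw [h0]
    exact Submodule.zero_mem _
  · exact F.mono (by omega) hm

/-- The map `G(A) → G(R)` induced by the coefficient on `x^α`. -/
noncomputable def grCoeff (hF : h.IsSigmaFiltered F) (α : Fin n → ℕ) :
    hF.filtration.G →ₗ[K] F.G :=
  hF.filtration.lift
    (fun p => F.toG (p - ∑ i, α i) ∘ₗ (h.coeffLin α).restrict fun _ ha => hF.coeff_mem ha α)
    fun _ _ ha hb => F.toG_eq_zero (hF.coeff_mem ha α) (hF.mem_filtration_below.mp hb α)

theorem grCoeff_toG (hF : h.IsSigmaFiltered F) (α : Fin n → ℕ) {p : ℕ} {a : A}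
    (ha : a ∈ hF.filtration.piece p) : hF.grCoeff α (hF.filtration.toG p ⟨a, ha⟩) =
      F.toG (p - ∑ i, α i) ⟨h.coeff a α, hF.coeff_mem ha α⟩ :=
  hF.filtration.lift_toG _ _ _ _

theorem grCoeff_monomial (hF : h.IsSigmaFiltered F) (g : F.G) (α β : Fin n → ℕ) :
    hF.grCoeff β (hF.Phi g * stdMonomial (fun i => hF.filtration.symbol (x i)) α) =
      if α = β then g else 0 := by
  induction g using F.G_induction with
  | zero => simp
  | toG p r hr =>
    obtain ⟨hm, he⟩ := hF.isCoset_monomial hr α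
    rw [he, hF.grCoeff_toG]
    split_ifs with hαβ
    · subst hαβ
      refine F.toG_congr _ _ (by omega) ?_
      rw [h.coeff_monomial, if_pos rfl]
    · refine F.toG_eq_zero _ ?_
      rw [h.coeff_monomial, if_neg hαβ]
      exact Submodule.zero_mem _
  | add g g' hg hg' =>
    rw [map_add, add_mul, map_add, hg, hg']
    split_ifs <;> simp

theorem exists_eq_sum_monomial (hF : h.IsSigmaFiltered F) (g : hF.filtration.G) :
    ∃ f : (Fin n → ℕ) →₀ F.G, g = f.sum fun α c =>
      hF.Phi c * stdMonomial (fun i => hF.filtration.symbol (x i)) α := by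
  induction g using hF.filtration.G_induction with
  | zero => exact ⟨0, by simp⟩
  | add g g' hg hg' =>
    obtain ⟨f, rfl⟩ := hg
    obtain ⟨f', rfl⟩ := hg'
    exact ⟨f + f', (Finsupp.sum_add_index' (by simp) (by simp [add_mul])).symm⟩
  | toG p a ha =>
    have hterm : ∀ α, φ (h.coeff a α) * stdMonomial x α ∈ hF.filtration.piece p := fun α => by
      rcases F.mem_below.mp (h.mem_tdegLE.mp ha α) with h0 | ⟨q, hq, hm⟩
      · rw [h0, map_zero, zero_mul]
        exact Submodule.zero_mem _
      · exact h.monomial_mem_tdegLE hm (by omega)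
    have hsum : hF.filtration.toG p ⟨a, ha⟩ =
        ∑ α ∈ (h.coeff a).support, hF.filtration.toG p ⟨_, hterm α⟩ := by
      rw [hF.filtration.toG_sum _ hterm]
      exact hF.filtration.toG_congr _ _ rfl (h.sum_coeff a).symm
    refine ⟨Finsupp.onFinset (h.coeff a).support
      (fun α => F.toG (p - ∑ i, α i) ⟨h.coeff a α, hF.coeff_mem ha α⟩) fun α hα => ?_, ?_⟩
    · rw [Finsupp.mem_support_iff]
      intro h0
      exact hα (F.toG_eq_zero _ (by rw [h0]; exact Submodule.zero_mem _))
    · rw [hsum, Finsupp.onFinset_sum _ (by simp)]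
      refine Finset.sum_congr rfl fun α hα => ?_
      obtain ⟨hm, he⟩ := hF.isCoset_monomial (hF.coeff_mem ha α) α
      rw [he]
      refine hF.filtration.toG_congr _ _ ?_ rfl
      -- A nonzero coefficient forces `|α| ≤ p`, so `p - |α| + |α| = p` despite truncated
      -- subtraction.
      rcases F.mem_below.mp (h.mem_tdegLE.mp ha α) with h0 | ⟨q, hq, -⟩
      · exact absurd h0 (Finsupp.mem_support_iff.mp hα)
      · omega

theorem grCoeff_sum (hF : h.IsSigmaFiltered F) (f : (Fin n → ℕ) →₀ F.G) (β : Fin n → ℕ) :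
    hF.grCoeff β (f.sum fun α c =>
      hF.Phi c * stdMonomial (fun i => hF.filtration.symbol (x i)) α) = f β := by
  simp only [Finsupp.sum, map_sum, hF.grCoeff_monomial]
  simp

theorem existsUnique_sum_monomial (hF : h.IsSigmaFiltered F) (g : hF.filtration.G) :
    ∃! f : (Fin n → ℕ) →₀ F.G, g = f.sum fun α c =>
      hF.Phi c * stdMonomial (fun i => hF.filtration.symbol (x i)) α := by
  obtain ⟨f, hf⟩ := hF.exists_eq_sum_monomial g
  refine ⟨f, hf, fun f' hf' => ?_⟩
  ext1 β
  rw [← hF.grCoeff_sum f' β, ← hf', hf, hF.grCoeff_sum]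

theorem Phi_injective (hF : h.IsSigmaFiltered F) : Function.Injective hF.Phi := by
  intro g g' hg
  have := hF.grCoeff_monomial g 0 0
  rw [hg, hF.grCoeff_monomial, if_pos rfl, if_pos rfl] at this
  exact this.symm

theorem sigmaHom_mem (hF : h.IsSigmaFiltered F) (i : Fin n) (p : ℕ) (r : R)
    (hr : r ∈ F.piece p) : h.sigmaHom i r ∈ F.piece p :=
  hF.sigma_mem i p r hr

theorem deltaLin_mem (hF : h.IsSigmaFiltered F) (i : Fin n) (p : ℕ) (r : R)
    (hr : r ∈ F.piece p) : h.deltaLin i r ∈ F.piece (p + 1) :=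
  hF.delta_mem i p r hr

/-- The graded endomorphism of `G(R)` induced by `σᵢ`. -/
noncomputable def grSigma (hF : h.IsSigmaFiltered F) (i : Fin n) : F.G →+* F.G :=
  F.grEnd (h.sigmaHom i) (hF.sigmaHom_mem i)

/-- The derivation of degree `1` of `G(R)` induced by `δᵢ`. -/
noncomputable def grDelta (hF : h.IsSigmaFiltered F) (i : Fin n) : F.G →ₗ[K] F.G :=
  F.grLin 1 (h.deltaLin i) (hF.deltaLin_mem i)

theorem grSigma_toG (hF : h.IsSigmaFiltered F) (i : Fin n) {p : ℕ} {r : R}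
    (hr : r ∈ F.piece p) :
    hF.grSigma i (F.toG p ⟨r, hr⟩) = F.toG p ⟨h.sigma i r, hF.sigma_mem i p r hr⟩ :=
  F.grEnd_toG _ _ hr

theorem grDelta_toG (hF : h.IsSigmaFiltered F) (i : Fin n) {p : ℕ} {r : R}
    (hr : r ∈ F.piece p) :
    hF.grDelta i (F.toG p ⟨r, hr⟩) = F.toG (p + 1) ⟨h.delta i r, hF.delta_mem i p r hr⟩ :=
  F.grLin_toG _ _ _ hr

/-- For `r` in the piece of degree `p`, this is the coset in degree `p + 1` of `xᵢ r = σᵢ(r) xᵢ +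
δᵢ(r)`, all of whose terms lie in that piece. -/
theorem symbol_var_mul_Phi (hF : h.IsSigmaFiltered F) (i : Fin n) (g : F.G) :
    hF.filtration.symbol (x i) * hF.Phi g =
      hF.Phi (hF.grSigma i g) * hF.filtration.symbol (x i) + hF.Phi (hF.grDelta i g) := by
  induction g using F.G_induction with
  | zero => simp
  | toG p r hr =>
    rw [hF.grSigma_toG, hF.grDelta_toG]
    obtain ⟨h1, e1⟩ := (hF.isCoset_var i).mul (hF.isCoset_Phi hr)
    obtain ⟨h2, e2⟩ := (hF.isCoset_Phi (hF.sigma_mem i p r hr)).mul (hF.isCoset_var i)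
    obtain ⟨h3, e3⟩ := hF.isCoset_Phi (hF.delta_mem i p r hr)
    rw [e1, e2, e3, ← map_add]
    exact hF.filtration.toG_congr _ _ (add_comm _ _) (h.var_mul_map i r)
  | add g g' hg hg' =>
    simp only [map_add, mul_add, add_mul, hg, hg']
    abel

theorem grDelta_mul (hF : h.IsSigmaFiltered F) (i : Fin n) (g g' : F.G) :
    hF.grDelta i (g * g') = hF.grSigma i g * hF.grDelta i g' + hF.grDelta i g * g' := by
  induction g using F.G_induction with
  | zero => simp
  | toG p r hr =>
    induction g' using F.G_induction with
    | zero => simp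
    | toG q s hs =>
      rw [F.toG_mul, hF.grDelta_toG, hF.grSigma_toG, hF.grDelta_toG, hF.grDelta_toG, F.toG_mul,
        F.toG_mul, F.toG_congr (F.mul_mem (hF.delta_mem i p r hr) hs)
          (q := p + (q + 1)) (b := h.delta i r * s) (by
            rw [show p + (q + 1) = p + 1 + q by omega]
            exact F.mul_mem (hF.delta_mem i p r hr) hs) (by omega) rfl, ← map_add]
      exact F.toG_congr _ _ (add_assoc _ _ _) (h.delta_mul i r s)
    | add g g' hg hg' =>
      simp only [map_add, mul_add, hg, hg']
      abel
  | add g₁ g₂ h₁ h₂ =>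
    simp only [map_add, add_mul, h₁, h₂]
    abel

theorem grSigma_bijective (hF : h.IsSigmaFiltered F)
    (hfin : ∀ p, FiniteDimensional K ↥(F.piece p)) (i : Fin n) :
    Function.Bijective (hF.grSigma i) :=
  F.grEnd_bijective hfin _ (h.sigmaHom_injective i) _

theorem symbol_var_mul_symbol_var (hF : h.IsSigmaFiltered F) {i j : Fin n} {c e : R}
    {f : Fin n → R} (hrel : x j * x i = φ c * (x i * x j) + φ e + ∑ l, φ (f l) * x l)
    (hc : c ∈ F.piece 0) (he : e ∈ F.piece 2) (hf : ∀ l, f l ∈ F.piece 1) :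
    hF.filtration.symbol (x j) * hF.filtration.symbol (x i) =
      hF.Phi (F.toG 0 ⟨c, hc⟩) * (hF.filtration.symbol (x i) * hF.filtration.symbol (x j)) +
        hF.Phi (F.toG 2 ⟨e, he⟩) +
        ∑ l, hF.Phi (F.toG 1 ⟨f l, hf l⟩) * hF.filtration.symbol (x l) := by
  obtain ⟨h1, e1⟩ := (hF.isCoset_var j).mul (hF.isCoset_var i)
  obtain ⟨h2, e2⟩ := (hF.isCoset_Phi hc).mul ((hF.isCoset_var i).mul (hF.isCoset_var j))
  obtain ⟨h3, e3⟩ := hF.isCoset_Phi he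
  choose h4 e4 using fun l => (hF.isCoset_Phi (hf l)).mul (hF.isCoset_var l)
  rw [e1, e2, e3, Finset.sum_congr rfl fun l _ => e4 l]
  rw [hF.filtration.toG_sum _ h4]
  -- The degrees `1 + 1` and `0 + (1 + 1)` both reduce to 2, so the cosets can be added.
  change hF.filtration.toG 2 ⟨_, h1⟩ = hF.filtration.toG 2 ⟨_, h2⟩ + _ + _
  rw [← map_add, ← map_add]
  exact hF.filtration.toG_congr _ _ rfl hrel

end IsSigmaFiltered

end IsSkewPBW

/-! ### The graded skew PBW structure and the explicit relations. -/

namespace IsSkewPBW.IsSigmaFiltered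

variable {K : Type u} {R : Type v} {A : Type w} [Field K] [Ring R] [Algebra K R]
  [Ring A] [Algebra K A] {n : ℕ} {φ : R →ₐ[K] A} {x : Fin n → A}
  {h : IsSkewPBW φ x} {F : AlgFiltration K R}

theorem gr_var_rel (hF : h.IsSigmaFiltered F)
    (hF0 : ∀ r ∈ F.piece 0, ∃ k : K, r = algebraMap K R k) (i j : Fin n) :
    ∃ d ∈ F.grading 0, d ≠ 0 ∧ IsUnit d ∧
      ∃ e ∈ F.grading 2, ∃ f : Fin n → F.G, (∀ l, f l ∈ F.grading 1) ∧
        hF.filtration.symbol (x j) * hF.filtration.symbol (x i) -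
          hF.Phi d * (hF.filtration.symbol (x i) * hF.filtration.symbol (x j)) =
            hF.Phi e + ∑ l, hF.Phi (f l) * hF.filtration.symbol (x l) := by
  have := h.nontrivial i
  obtain ⟨c, e, f, -, hrel⟩ := h.exists_rel i j
  obtain ⟨⟨k, hk, rfl⟩, he, hf⟩ := hF.rel_mem hF0 i j hrel
  have hu : IsUnit (F.toG 0 ⟨_, F.algebraMap_mem_piece_zero k⟩) := by
    rw [F.toG_algebraMap]
    exact (IsUnit.mk0 k hk).map (algebraMap K F.G)
  refine ⟨_, F.toG_mem_grading ⟨_, F.algebraMap_mem_piece_zero k⟩, hu.ne_zero, hu,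
    _, F.toG_mem_grading ⟨e, he⟩, fun l => F.toG 1 ⟨f l, hf l⟩, fun l => F.toG_mem_grading _, ?_⟩
  rw [hF.symbol_var_mul_symbol_var hrel (F.algebraMap_mem_piece_zero k) he hf]
  abel

/-- The associated graded algebra of a `σ`-filtered skew PBW extension is a graded skew PBW
extension, when the pieces are finite-dimensional and the elements of degree `0` are scalars. -/
theorem isGradedSkewPBW (hF : h.IsSigmaFiltered F)
    (hfin : ∀ p, FiniteDimensional K ↥(F.piece p))
    (hF0 : ∀ r ∈ F.piece 0, ∃ k : K, r = algebraMap K R k) :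
    IsGradedSkewPBW F.grading hF.Phi fun i => hF.filtration.symbol (x i) where
  isSkewPBW :=
    { injective := hF.Phi_injective
      basis := hF.existsUnique_sum_monomial
      comm_coeff := fun i g hg =>
        ⟨hF.grSigma i g, (map_ne_zero_iff _ (hF.grSigma_bijective hfin i).injective).mpr hg,
          hF.grDelta i g, by rw [hF.symbol_var_mul_Phi, add_sub_cancel_left]⟩
      comm_var := fun i j => by
        obtain ⟨d, -, hd, -, e, -, f, -, hrel⟩ := hF.gr_var_rel hF0 i j
        exact ⟨d, hd, e, f, hrel⟩ }
  isInternal := F.isInternal_grading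
  gradedMonoid := F.gradedMonoid_grading
  coeff_rel i := ⟨hF.grSigma i, (hF.grDelta i).toAddMonoidHom, hF.symbol_var_mul_Phi i,
    hF.grDelta_mul i, hF.grSigma_bijective hfin i, fun _ _ hg => F.grEnd_mem_grading _ _ hg,
    fun _ _ hg => F.grLin_mem_grading _ _ _ hg⟩
  var_rel i j := by
    obtain ⟨d, hd, hd0, hu, H⟩ := hF.gr_var_rel hF0 i j
    exact ⟨d, hd, hd0, fun _ => hu, H⟩

theorem symbol_var_mul_Phi_symbol (hF : h.IsSigmaFiltered F)
    (hfin : ∀ p, FiniteDimensional K ↥(F.piece p))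
    (hF0 : ∀ r ∈ F.piece 0, ∃ k : K, r = algebraMap K R k) (i : Fin n) {t : R}
    (ht : t ∈ F.piece 1) :
    hF.filtration.symbol (x i) * hF.Phi (F.symbol t) =
      hF.Phi (F.symbol (h.sigma i t)) * hF.filtration.symbol (x i) +
        hF.Phi (if F.deg (h.delta i t) = 2 then F.symbol (h.delta i t) else 0) := by
  -- Were the degree to drop, the symbol of `σᵢ(t)` would no longer be the image of the symbol of
  -- `t`.
  have hdeg : F.deg (h.sigma i t) = F.deg t :=
    F.deg_apply hfin (h.sigmaHom i) (h.sigmaHom_injective i) (hF.sigmaHom_mem i) t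
  rw [hF.symbol_var_mul_Phi, ← F.toG_eq_ite_symbol (hF.delta_mem i 1 t ht),
    F.symbol_eq_toG (F.mem_piece_deg t) rfl, hF.grSigma_toG,
    ← F.symbol_eq_toG (hF.sigma_mem i _ t (F.mem_piece_deg t)) hdeg, hF.grDelta_toG]
  congr 2
  -- A generator may have degree 0 in `R`; it is then a scalar, which `δᵢ` kills, so both cosets
  -- vanish although their degrees differ.
  by_cases h1 : F.deg t = 1
  · exact F.toG_congr _ _ (by rw [h1]) rfl
  · have := F.deg_le_iff.mpr ht
    obtain ⟨k, rfl⟩ := hF0 t (F.deg_le_iff.mp (by omega))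
    simp only [h.delta_algebraMap]
    rw [F.toG_eq_zero _ (Submodule.zero_mem _), F.toG_eq_zero _ (Submodule.zero_mem _)]

theorem symbol_var_mul_symbol_var' (hF : h.IsSigmaFiltered F)
    (hF0 : ∀ r ∈ F.piece 0, ∃ k : K, r = algebraMap K R k) (i j : Fin n) (c e : R) (f : Fin n → R)
    (hrel : x j * x i = φ c * (x i * x j) + φ e + ∑ l, φ (f l) * x l) :
    hF.filtration.symbol (x j) * hF.filtration.symbol (x i) =
      hF.Phi (F.symbol c) * (hF.filtration.symbol (x i) * hF.filtration.symbol (x j)) +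
        hF.Phi (if F.deg e = 2 then F.symbol e else 0) +
        ∑ l, hF.Phi (if F.deg (f l) = 1 then F.symbol (f l) else 0) *
          hF.filtration.symbol (x l) := by
  obtain ⟨⟨k, -, rfl⟩, he, hf⟩ := hF.rel_mem hF0 i j hrel
  have hc := F.algebraMap_mem_piece_zero k
  rw [hF.symbol_var_mul_symbol_var hrel hc he hf, ← F.toG_eq_ite_symbol he,
    F.symbol_eq_toG hc (Nat.le_zero.mp (F.deg_le_iff.mpr hc))]
  simp only [← F.toG_eq_ite_symbol (hf _)]

end IsSkewPBW.IsSigmaFiltered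

theorem mainTheorem6 {K : Type u} {R : Type v} {A : Type w} [Field K] [Ring R] [Algebra K R]
    [Ring A] [Algebra K A] {m s n : ℕ}
    (rel : Fin s → FreeAlgebra K (Fin m)) (π : FreeAlgebra K (Fin m) →ₐ[K] R)
    (hπ : IsPresentation rel π) (φ : R →ₐ[K] A) (x : Fin n → A) (hx : IsSkewPBW φ x)
    (hfil : hx.IsSigmaFiltered (stdFiltration π hπ.surjective)) :
    let FR : AlgFiltration K R := stdFiltration π hπ.surjective
    let t : Fin m → R := fun k => π (FreeAlgebra.ι K k)
    ∃ (FA : AlgFiltration K A) (_ : ∀ p a, a ∈ FA.piece p ↔ hx.tdeg FR a ≤ p)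
      (hφ : ∀ p, ∀ r ∈ FR.piece p, φ r ∈ FA.piece p),
      let Φ : FR.G →ₐ[K] FA.G := FR.grMap FA φ hφ
      let y : Fin n → FA.G := fun i => FA.symbol (x i)
      IsGradedSkewPBW FR.grading Φ y ∧
      (∀ (i : Fin n) (k : Fin m),
        y i * Φ (FR.symbol (t k)) = Φ (FR.symbol (hx.sigma i (t k))) * y i +
          Φ (if FR.deg (hx.delta i (t k)) = 2 then FR.symbol (hx.delta i (t k)) else 0)) ∧
      (∀ (i j : Fin n) (c e : R) (f : Fin n → R),
        x j * x i = φ c * (x i * x j) + φ e + ∑ l, φ (f l) * x l →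
        y j * y i = Φ (FR.symbol c) * (y i * y j) +
          Φ (if FR.deg e = 2 then FR.symbol e else 0) +
          ∑ l, Φ (if FR.deg (f l) = 1 then FR.symbol (f l) else 0) * y l) := by
  exact ⟨hfil.filtration, fun _ _ => hfil.mem_filtration, hfil.map_mem,
    hfil.isGradedSkewPBW (stdFiltration_finiteDimensional π hπ.surjective)
      fun _ => mem_stdFiltration_zero,
    fun i k => hfil.symbol_var_mul_Phi_symbol (stdFiltration_finiteDimensional π hπ.surjective)
      (fun _ => mem_stdFiltration_zero) i (Submodule.subset_span ⟨[k], by simp⟩),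
    hfil.symbol_var_mul_symbol_var' fun _ => mem_stdFiltration_zero⟩
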